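/- Let a boolean matrix be a matrix with entries in $\{0,1\}$. For a real $m\times n$ matrix $A$, let $$\gamma_2(A)=\min_{A=UV}\ \|U\|_{\mathrm{row}}\,\|V\|_{\mathrm{col}},$$ where the minimum is over all real factorizations $A=UV$ (with any inner dimension), $\|U\|_{\mathrm{row}}$ is the maximum $\ell^2$-norm of a row of $U$, and $\|V\|_{\mathrm{col}}$ is the maximum $\ell^2$-norm of a column of $V$. An $m\times n$ boolean matrix $B$ is called blocky if there are pairwise disjoint sets $S_1,\dots,S_k\subseteq[m]$ and pairwise disjoint sets $T_1,\dots,T_k\subseteq[n]$ such that the support of $B$ is exactly $\bigcup_{l=1}^k S_l\times T_l$. Theorem. There is an absolute constant $C>0$ such that the following holds for all $m,n$ and all real $\lambda$. Let $A$ be an $m\times n$ boolean matrix with $\gamma_2(A)\le\lambda$, and let $F$ be the number of $1$-entries of $A$. Then there is an $m\times n$ blocky matrix $B$ with at least $F/2^{2^{C\lambda}}$ $1$-entries such that, for all $(i,j)\in[m]\times[n]$, $B(i,j)=1$ only if $A(i,j)=1$. -/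

import Mathlib

/-- A real matrix is boolean if all its entries lie in `{0, 1}`. -/
def IsBoolean {m n : ℕ} (A : Matrix (Fin m) (Fin n) ℝ) : Prop :=
  ∀ i j, A i j = 0 ∨ A i j = 1

/-- The maximum Euclidean norm of a row of `U` (it is `0` if there are no rows). -/
noncomputable def maxRowNorm {m t : ℕ} (U : Matrix (Fin m) (Fin t) ℝ) : ℝ :=
  ⨆ i, Real.sqrt (∑ k, U i k ^ 2)

/-- The maximum Euclidean norm of a column of `V` (it is `0` if there are no columns). -/
noncomputable def maxColNorm {t n : ℕ} (V : Matrix (Fin t) (Fin n) ℝ) : ℝ :=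
  ⨆ j, Real.sqrt (∑ k, V k j ^ 2)

/-- The `γ₂` factorization norm: the least value of `maxRowNorm U * maxColNorm V` over all
factorizations `A = U * V` through `ℝ ^ t`, for all `t`. The set of these values is nonempty
(`A = A * 1`) and bounded below by `0`. -/
noncomputable def gammaTwo {m n : ℕ} (A : Matrix (Fin m) (Fin n) ℝ) : ℝ :=
  sInf {c : ℝ | ∃ (t : ℕ) (U : Matrix (Fin m) (Fin t) ℝ) (V : Matrix (Fin t) (Fin n) ℝ),
    A = U * V ∧ c = maxRowNorm U * maxColNorm V}

/-- A boolean matrix is blocky if there are pairwise disjoint sets `S 0, …, S (k - 1)` of rows and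
pairwise disjoint sets `T 0, …, T (k - 1)` of columns such that its support is exactly the union of
the rectangles `S l × T l`. -/
def IsBlocky {m n : ℕ} (B : Matrix (Fin m) (Fin n) ℝ) : Prop :=
  IsBoolean B ∧
    ∃ (k : ℕ) (S : Fin k → Finset (Fin m)) (T : Fin k → Finset (Fin n)),
      (∀ a b, a ≠ b → Disjoint (S a) (S b)) ∧
      (∀ a b, a ≠ b → Disjoint (T a) (T b)) ∧
      ∀ i j, B i j ≠ 0 ↔ ∃ l, i ∈ S l ∧ j ∈ T l

open Classical in
/-- The number of entries of `A` that are equal to `1`. -/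
noncomputable def numOnes {m n : ℕ} (A : Matrix (Fin m) (Fin n) ℝ) : ℕ :=
  (Finset.univ.filter fun p : Fin m × Fin n => A p.1 p.2 = 1).card

/-! Write the entries of `A` as inner products `⟪u i, v j⟫` of vectors of squared norm at most `L`,
where `L ≤ λ + 2`, and view `A` as a bipartite graph. It suffices to find one all-ones rectangle `S
× T` whose rows and columns together meet at most `K * #S * #T` edges, `K = 2 ^ (10 ^ 6 * L ^ 6)`
(`exists_cheap_rectangle`). Deleting its rows and columns and repeating gives rectangles with
disjoint sides and total area at least `F / K`, and `K` is far below the double exponential allowed.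

Such a rectangle rests on four facts.

Regularity (`exists_regular_block`): some block keeps a `1 / poly(L)` proportion of the degrees of
its rows and columns, which are about constant. Otherwise the rows would spread their edges over
many degree scales. One could then subtract from the `u i` large multiples of averages over
neighbourhoods, scale by scale, while hardly disturbing the inner products still needed; the energy
spent would exceed the initial `∑ ‖u i‖ ^ 2`, suitably weighted.

Dense neighbourhoods (`exists_edge_dense_neighbourhoods`): if a regular block had few 4-cycles,
iterating `X ↦ X - c • A Aᵀ X` would preserve the correlation with the `v j` for too long, again
exhausting the energy. So some edge `i ∼ j` has about `a * b / poly(L)` edges between the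
neighbourhoods of `j` and `i`.

Density increment (`boost_step`): rounding with random signs selects ones slightly more often than
zeros, so iteration makes zeros as rare as desired.

Sparse complement (`exists_zero_rectangle`): columns sharing a neighbour have vectors with a long
mean. Subtracting an average of a few of them shortens many of them and alters no inner product with
rows outside a small set. After boundedly many rounds either many empty columns have appeared or the
vectors vanish, and either way there is a zero rectangle. -/

section

open Finset
open scoped Classical

/-! ### Degrees and the basic energy inequality -/

section Energy

variable {ι κ H : Type*} [NormedAddCommGroup H] [InnerProductSpace ℝ H]

/-- The degree of a column `j` into a set `R` of rows. -/
noncomputable def colDeg (E : ι → κ → Prop) (R : Finset ι) (j : κ) : ℕ := #{i ∈ R | E i j}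

/-- The degree of a row `i` into a set `C` of columns. -/
noncomputable def rowDeg (E : ι → κ → Prop) (C : Finset κ) (i : ι) : ℕ := #{j ∈ C | E i j}

/-- The number of edges between a set `R` of rows and a set `C` of columns. -/
noncomputable def edgeCount (E : ι → κ → Prop) (R : Finset ι) (C : Finset κ) : ℕ :=
  ∑ i ∈ R, rowDeg E C i

lemma sum_filter_swap {M : Type*} [AddCommMonoid M] (P : ι → κ → Prop)
    [∀ i j, Decidable (P i j)] (R : Finset ι) (C : Finset κ) (f : ι → κ → M) :
    ∑ i ∈ R, ∑ j ∈ C with P i j, f i j = ∑ j ∈ C, ∑ i ∈ R with P i j, f i j :=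
  sum_comm' (by intro x y; simp only [mem_filter]; tauto)

lemma edgeCount_eq_sum_colDeg (E : ι → κ → Prop) (R : Finset ι) (C : Finset κ) :
    edgeCount E R C = ∑ j ∈ C, colDeg E R j := by
  simp only [edgeCount, rowDeg, colDeg, card_eq_sum_ones]
  exact sum_filter_swap E R C _

/-- Expand the square. Regrouped by columns, the cross term gives `-2 * c * ∑ β j * ‖Y j‖ ^ 2`. A
weighted Cauchy–Schwarz bound (a Schur test, using `hγ` and `hd`) shows that the quadratic term
returns at most half of this. -/
lemma energy_decrement {R : Finset ι} {C : Finset κ} {P : ι → κ → Prop}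
    [∀ i j, Decidable (P i j)] {X : ι → H} {Y : κ → H}
    {ρ α : ι → ℝ} {β γ : κ → ℝ} {c : ℝ} (hc : 0 ≤ c) (hα : ∀ i ∈ R, 0 ≤ α i)
    (hβ : ∀ j ∈ C, 0 ≤ β j) (hY : ∀ j ∈ C, Y j = ∑ i ∈ R with P i j, X i)
    (hρ : ∀ i ∈ R, ∀ j ∈ C, P i j → ρ i * α i = c)
    (hγ : ∀ i ∈ R, α i * ∑ j ∈ C with P i j, γ j ≤ 1)
    (hd : ∀ j ∈ C, (#{i ∈ R | P i j} : ℝ) * β j ≤ γ j) :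
    ∑ i ∈ R, ρ i * ‖X i - α i • ∑ j ∈ C with P i j, β j • Y j‖ ^ 2 + c * ∑ j ∈ C, β j * ‖Y j‖ ^ 2
      ≤ ∑ i ∈ R, ρ i * ‖X i‖ ^ 2 := by
  set n : κ → ℝ := fun j => (#{i ∈ R | P i j} : ℝ) with hn
  have hi : ∀ i ∈ R, ρ i * ‖X i - α i • ∑ j ∈ C with P i j, β j • Y j‖ ^ 2 ≤ ρ i * ‖X i‖ ^ 2
      - 2 * c * ∑ j ∈ C with P i j, β j * inner ℝ (X i) (Y j)
      + c * ∑ j ∈ C with P i j, β j / n j * ‖Y j‖ ^ 2 := by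
    intro i hi
    by_cases he : ∃ j ∈ C, P i j
    · obtain ⟨j₀, hj₀, hp⟩ := he
      have hr := hρ i hi j₀ hj₀ hp
      have hz : ‖∑ j ∈ C with P i j, β j • Y j‖ ^ 2 ≤
          (∑ j ∈ C with P i j, γ j) * ∑ j ∈ C with P i j, β j / n j * ‖Y j‖ ^ 2 := by
        have h1 : ‖∑ j ∈ C with P i j, β j • Y j‖ ≤ ∑ j ∈ C with P i j, β j * ‖Y j‖ := by
          refine (norm_sum_le _ _).trans (le_of_eq (sum_congr rfl fun j hj => ?_))
          rw [norm_smul, Real.norm_of_nonneg (hβ j (mem_filter.1 hj).1)]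
        refine (pow_le_pow_left₀ (norm_nonneg _) h1 2).trans ?_
        have hnpos : ∀ j ∈ C.filter (fun j => P i j), 1 ≤ n j := by
          intro j hj
          have : 0 < #{i ∈ R | P i j} := card_pos.2 ⟨i, by simp [hi, (mem_filter.1 hj).2]⟩
          exact Nat.one_le_cast.2 this
        refine sum_sq_le_sum_mul_sum_of_sq_le_mul _ (fun j hj => ?_) (fun j hj => ?_)
          fun j hj => ?_
        · have hjC := (mem_filter.1 hj).1
          exact (mul_nonneg (by simp) (hβ j hjC)).trans (hd j hjC)
        · have hjC := (mem_filter.1 hj).1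
          have := hβ j hjC
          positivity
        · have hjC := (mem_filter.1 hj).1
          have h0 := hβ j hjC
          have h2 := hd j hjC
          have h3 := hnpos j hj
          have h4 : β j ≤ γ j / n j := by rw [le_div_iff₀ (by linarith)]; linarith
          calc (β j * ‖Y j‖) ^ 2 = β j * (β j * ‖Y j‖ ^ 2) := by ring
            _ ≤ γ j / n j * (β j * ‖Y j‖ ^ 2) := by gcongr
            _ = _ := by ring
      have h5 : α i * ‖∑ j ∈ C with P i j, β j • Y j‖ ^ 2 ≤
          ∑ j ∈ C with P i j, β j / n j * ‖Y j‖ ^ 2 := by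
        have h6 : 0 ≤ ∑ j ∈ C with P i j, β j / n j * ‖Y j‖ ^ 2 := by
          refine sum_nonneg fun j hj => ?_
          have := hβ j (mem_filter.1 hj).1
          positivity
        have h7 := mul_le_mul_of_nonneg_left hz (hα i hi)
        have h8 := mul_le_mul_of_nonneg_right (hγ i hi) h6
        linarith
      rw [norm_sub_sq_real, inner_smul_right, inner_sum, norm_smul]
      simp only [inner_smul_right, Real.norm_eq_abs, mul_pow, sq_abs]
      have h9 := mul_le_mul_of_nonneg_left h5 hc
      rw [← hr] at h9 ⊢
      linarith
    · have : C.filter (fun j => P i j) = ∅ := by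
        ext j; simp; exact fun hj hp => he ⟨j, hj, hp⟩
      simp [this]
  have hsum := sum_le_sum hi
  rw [sum_add_distrib, sum_sub_distrib, ← mul_sum, ← mul_sum,
    sum_filter_swap P R C fun i j => β j * inner ℝ (X i) (Y j),
    sum_filter_swap P R C fun _ j => β j / n j * ‖Y j‖ ^ 2] at hsum
  have hA : ∑ j ∈ C, ∑ i ∈ R with P i j, β j * inner ℝ (X i) (Y j) = ∑ j ∈ C, β j * ‖Y j‖ ^ 2 := by
    refine sum_congr rfl fun j hj => ?_
    rw [← mul_sum, ← sum_inner, ← hY j hj, real_inner_self_eq_norm_sq]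
  have hB : ∑ j ∈ C, ∑ i ∈ R with P i j, β j / n j * ‖Y j‖ ^ 2 ≤ ∑ j ∈ C, β j * ‖Y j‖ ^ 2 := by
    refine sum_le_sum fun j hj => ?_
    rw [sum_const, nsmul_eq_mul]
    change n j * _ ≤ _
    by_cases h0 : n j = 0
    · rw [h0, zero_mul]; have := hβ j hj; positivity
    · refine le_of_eq ?_
      field_simp
  rw [hA] at hsum
  have := mul_le_mul_of_nonneg_left hB hc
  linarith

end Energy

/-! ### Peeling columns of separated degrees -/

section Concentration

variable {ι κ H : Type*} [NormedAddCommGroup H] [InnerProductSpace ℝ H]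

/-- Successive subtraction, layer by layer (layers being the fibres of `cl`), of weighted
averages over common neighbours. -/
noncomputable def peel (P : ι → κ → Prop) [∀ i j, Decidable (P i j)] (R : Finset ι) (C : Finset κ) (α : ι → ℝ) (β : κ → ℝ)
    (cl : κ → ℕ) (u : ι → H) : ℕ → ι → H
  | 0 => u
  | s + 1 => fun i => peel P R C α β cl u s i -
      α i • ∑ j ∈ C with P i j ∧ cl j = s,
        β j • ∑ i' ∈ R with P i' j ∧ cl j = s, peel P R C α β cl u s i'

set_option maxHeartbeats 1000000 in
/-- Layers of columns of geometrically separated degrees: if no row has more than a fraction `θ`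
of its weight in a single layer of `P`, then `P` has small weight. -/
lemma spread_weight_sq_le {R : Finset ι} {C : Finset κ} {E P : ι → κ → Prop}
    [∀ i j, Decidable (P i j)] {u : ι → H}
    {v : κ → H} {ω : κ → ℝ} {θ Bu Bv : ℝ} {cl : κ → ℕ} (hθ : 0 < θ) (hω : ∀ j ∈ C, 0 < ω j)
    (hPE : ∀ i j, P i j → E i j)
    (huv : ∀ i ∈ R, ∀ j ∈ C, inner ℝ (u i) (v j) = if E i j then 1 else 0)
    (hu : ∀ i ∈ R, ‖u i‖ ^ 2 ≤ Bu) (hv : ∀ j ∈ C, ‖v j‖ ^ 2 ≤ Bv)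
    (hcl : ∀ j ∈ C, ∀ j' ∈ C, (∃ i ∈ R, P i j) → (∃ i ∈ R, P i j') → cl j < cl j' →
      colDeg E R j' * 8 ^ (cl j' - cl j) ≤ colDeg E R j)
    (hP : ∀ i ∈ R, ∀ s, ∑ j ∈ C with P i j ∧ cl j = s, ω j ≤ θ * ∑ j ∈ C with E i j, ω j) :
    (∑ i ∈ R, ∑ j ∈ C with P i j, ω j) ^ 2 ≤
      4 * Bu * Bv * θ * (∑ j ∈ C, ω j * colDeg E R j) ^ 2 := by
  set D : ι → ℝ := fun i => ∑ j ∈ C with E i j, ω j with hD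
  -- The step is `1 / θ` times the natural `1 / D i`. It remains stable because one layer carries at
  -- most `θ * D i` of the weight of row `i`; this gain is the source of the factor `θ` in the
  -- conclusion.
  set α : ι → ℝ := fun i => 1 / (θ * D i) with hα
  set β : κ → ℝ := fun j => ω j / colDeg E R j with hβ
  set X := peel P R C α β cl u 
  have hsucc : ∀ s i, X (s + 1) i = X s i - α i • ∑ j ∈ C with P i j ∧ cl j = s,
      β j • ∑ i' ∈ R with P i' j ∧ cl j = s, X s i' := fun _ _ => rfl
  have hX0 : X 0 = u := rfl
  clear_value X
  set F : ℝ := ∑ j ∈ C, ω j * colDeg E R j with hF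
  have hD0 : ∀ i, 0 ≤ D i := fun i => sum_nonneg fun j hj => (hω j (mem_filter.1 hj).1).le
  have hα0 : ∀ i, 0 ≤ α i := fun i => by have := hD0 i; positivity
  have hβ0 : ∀ j ∈ C, 0 ≤ β j := fun j hj => by have := hω j hj; positivity
  have hαω : ∀ i ∈ R, ∀ s, α i * ∑ j ∈ C with P i j ∧ cl j = s, ω j ≤ 1 := by
    intro i hi s
    have h1 := mul_le_mul_of_nonneg_left (hP i hi s) (hα0 i)
    refine h1.trans ?_
    change 1 / (θ * D i) * (θ * D i) ≤ 1
    by_cases h : θ * D i = 0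
    · rw [h]; simp
    · rw [one_div_mul_cancel h]
  have hFD : ∑ i ∈ R, D i = F := by
    rw [hF, hD, sum_filter_swap]
    refine sum_congr rfl fun j _ => ?_
    rw [sum_const, nsmul_eq_mul, mul_comm]; rfl
  have hnd : ∀ j, #{i ∈ R | P i j} ≤ colDeg E R j := fun j =>
    card_le_card fun i hi => by
      simp only [mem_filter] at hi ⊢; exact ⟨hi.1, hPE _ _ hi.2⟩
  -- energy
  have hstep : ∀ s, ∑ i ∈ R, D i * ‖X (s + 1) i‖ ^ 2 + 1 / θ *
      ∑ j ∈ C, β j * ‖∑ i ∈ R with P i j ∧ cl j = s, X s i‖ ^ 2 ≤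
        ∑ i ∈ R, D i * ‖X s i‖ ^ 2 := by
    intro s
    simp only [hsucc]
    refine energy_decrement (R := R) (C := C) (P := fun i j => P i j ∧ cl j = s) (X := X s)
      (Y := fun j => ∑ i ∈ R with P i j ∧ cl j = s, X s i) (ρ := D) (α := α) (β := β) (γ := ω)
      (c := 1 / θ) (by positivity)
      (fun i _ => hα0 i) hβ0 (fun j _ => rfl) ?_ (fun i hi => hαω i hi s) ?_
    · intro i hi j hj hp
      have : 0 < D i := by
        refine sum_pos' (fun j hj => (hω j (mem_filter.1 hj).1).le) ⟨j, ?_, hω j hj⟩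
        simp [hj, hPE _ _ hp.1]
      simp only [hα]; field_simp
    · intro j hj
      have h1 : #{i ∈ R | P i j ∧ cl j = s} ≤ colDeg E R j :=
        (card_le_card fun i hi => by simp only [mem_filter] at hi ⊢; tauto).trans (hnd j)
      have h2 : (#{i ∈ R | P i j ∧ cl j = s} : ℝ) ≤ colDeg E R j := by exact_mod_cast h1
      have h3 := hω j hj
      simp only [hβ]
      by_cases h : (colDeg E R j : ℝ) = 0
      · rw [h]; simp [h3.le]
      · have h4 : (0 : ℝ) < colDeg E R j := lt_of_le_of_ne (by positivity) (Ne.symm h)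
        rw [← mul_div_assoc, div_le_iff₀ h4, mul_comm]
        gcongr
  have htot : ∀ S, ∑ i ∈ R, D i * ‖X S i‖ ^ 2 + ∑ s ∈ range S, 1 / θ *
      ∑ j ∈ C, β j * ‖∑ i ∈ R with P i j ∧ cl j = s, X s i‖ ^ 2 ≤
        ∑ i ∈ R, D i * ‖u i‖ ^ 2 := by
    intro S
    induction S with
    | zero => simp [hX0]
    | succ S ih => rw [sum_range_succ]; have := hstep S; linarith
  have henergy : ∑ j ∈ C, β j * ‖∑ i ∈ R with P i j, X (cl j) i‖ ^ 2 ≤ θ * (Bu * F) := by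
    have h1 := htot (C.sup cl + 1)
    have h2 : ∑ i ∈ R, D i * ‖u i‖ ^ 2 ≤ Bu * F := by
      rw [← hFD, mul_sum]
      refine sum_le_sum fun i hi => ?_
      rw [mul_comm]; exact mul_le_mul_of_nonneg_right (hu i hi) (hD0 i)
    have h3 : 0 ≤ ∑ i ∈ R, D i * ‖X (C.sup cl + 1) i‖ ^ 2 :=
      sum_nonneg fun i _ => mul_nonneg (hD0 i) (by positivity)
    rw [← mul_sum, sum_comm] at h1
    have h4 : ∑ j ∈ C, β j * ‖∑ i ∈ R with P i j, X (cl j) i‖ ^ 2 ≤ ∑ j ∈ C,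
        ∑ s ∈ range (C.sup cl + 1), β j * ‖∑ i ∈ R with P i j ∧ cl j = s, X s i‖ ^ 2 := by
      refine sum_le_sum fun j hj => ?_
      have := single_le_sum (f := fun s => β j * ‖∑ i ∈ R with P i j ∧ cl j = s, X s i‖ ^ 2)
        (s := range (C.sup cl + 1)) (fun s _ => mul_nonneg (hβ0 j hj) (by positivity))
        (mem_range.2 (Nat.lt_succ_of_le (le_sup hj)))
      simpa using this
    have h5 := h4.trans' (le_refl _)
    have h6 : 1 / θ * ∑ j ∈ C, β j * ‖∑ i ∈ R with P i j, X (cl j) i‖ ^ 2 ≤ Bu * F := by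
      have := mul_le_mul_of_nonneg_left h4 (by positivity : 0 ≤ 1 / θ)
      linarith
    rw [one_div_mul_eq_div, div_le_iff₀ hθ] at h6
    linarith
  -- the inner products stay close to the entries
  have hclose : ∀ j₀ ∈ C, (∃ i ∈ R, P i j₀) → ∀ s ≤ cl j₀, ∀ i ∈ R,
      |inner ℝ (X s i) (v j₀) - if E i j₀ then 1 else 0| ≤ 2 / 7 * (1 / 8) ^ (cl j₀ - s) := by
    intro j₀ hj₀ hne s
    induction s with
    | zero =>
      intro _ i hi
      rw [hX0, huv i hi j₀ hj₀, sub_self, abs_zero]; positivity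
    | succ s ih =>
      intro hs i hi
      have ih' := ih (by omega)
      -- Error budget: layer `s` moves the inner product by at most `ε + 2 / 7 * ε`. The new error
      -- `11 / 7 * ε` is below the `16 / 7 * ε` allowed at `s + 1`.
      set ε : ℝ := (1 / 8) ^ (cl j₀ - s) with hε
      have hε0 : 0 < ε := by positivity
      have hε1 : (1 / 8 : ℝ) ^ (cl j₀ - (s + 1)) = 8 * ε := by
        rw [hε, show cl j₀ - s = cl j₀ - (s + 1) + 1 by omega, pow_succ]; ring
      have ht : ∀ j ∈ C, P i j ∧ cl j = s → |inner ℝ (β j • ∑ i' ∈ R with P i' j ∧ cl j = s, X s i')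
          (v j₀)| ≤ ω j * (9 / 7 * ε) := by
        intro j hj hp
        have hdpos : 0 < colDeg E R j := card_pos.2 ⟨i, by simp [hi, hPE _ _ hp.1]⟩
        have hd' : (0 : ℝ) < colDeg E R j := by exact_mod_cast hdpos
        have hw := hω j hj
        rw [real_inner_smul_left, sum_inner, abs_mul, abs_of_nonneg (hβ0 j hj)]
        have h1 : |∑ i' ∈ R with P i' j ∧ cl j = s, inner ℝ (X s i') (v j₀)| ≤
            9 / 7 * ε * colDeg E R j := by
          have h2 : |∑ i' ∈ R with P i' j ∧ cl j = s, inner ℝ (X s i') (v j₀)| ≤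
              ∑ i' ∈ R with P i' j ∧ cl j = s, ((if E i' j₀ then 1 else 0) + 2 / 7 * ε) := by
            refine (abs_sum_le_sum_abs _ _).trans (sum_le_sum fun i' hi' => ?_)
            have h3 := ih' i' (mem_filter.1 hi').1
            have h4 := abs_add_le (inner ℝ (X s i') (v j₀) - if E i' j₀ then (1 : ℝ) else 0)
              (if E i' j₀ then (1 : ℝ) else 0)
            rw [sub_add_cancel] at h4
            have h5 : |if E i' j₀ then (1 : ℝ) else 0| = if E i' j₀ then 1 else 0 := by
              split_ifs <;> simp
            rw [h5] at h4
            linarith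
          refine h2.trans ?_
          rw [sum_add_distrib]
          have h6 : ∑ i' ∈ R with P i' j ∧ cl j = s, (if E i' j₀ then (1 : ℝ) else 0) ≤
              colDeg E R j₀ := by
            rw [sum_ite, sum_const_zero, add_zero, sum_const, nsmul_eq_mul, mul_one]
            have : #{x ∈ R.filter (fun i' => P i' j ∧ cl j = s) | E x j₀} ≤ colDeg E R j₀ :=
              card_le_card fun x hx => by simp only [mem_filter] at hx ⊢; tauto
            exact_mod_cast this
          -- Earlier layers consist of columns of much larger degree, so at most a fraction `ε` of
          -- the neighbours of `j` can be adjacent to `j₀`.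
          have h7 : (colDeg E R j₀ : ℝ) ≤ ε * colDeg E R j := by
            have h8 := hcl j hj j₀ hj₀ ⟨i, hi, hp.1⟩ hne (by omega)
            rw [hp.2] at h8
            have h9 : (colDeg E R j₀ : ℝ) * 8 ^ (cl j₀ - s) ≤ colDeg E R j := by exact_mod_cast h8
            have h10 : ε * 8 ^ (cl j₀ - s) = 1 := by rw [hε, ← mul_pow]; norm_num
            calc (colDeg E R j₀ : ℝ) = ε * (colDeg E R j₀ * 8 ^ (cl j₀ - s)) := by
                  rw [mul_comm (colDeg E R j₀ : ℝ), ← mul_assoc, h10, one_mul]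
              _ ≤ _ := by gcongr
          have h11 : ∑ i' ∈ R with P i' j ∧ cl j = s, 2 / 7 * ε ≤ colDeg E R j * (2 / 7 * ε) := by
            rw [sum_const, nsmul_eq_mul]
            have h1 : #{i ∈ R | P i j ∧ cl j = s} ≤ colDeg E R j :=
              (card_le_card fun i hi => by simp only [mem_filter] at hi ⊢; tauto).trans (hnd j)
            have h2 : (#{i ∈ R | P i j ∧ cl j = s} : ℝ) ≤ colDeg E R j := by exact_mod_cast h1
            gcongr
          linarith
        calc β j * _ ≤ β j * (9 / 7 * ε * colDeg E R j) :=
              mul_le_mul_of_nonneg_left h1 (hβ0 j hj)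
          _ = _ := by simp only [hβ]; field_simp
      have hcorr : |inner ℝ (α i • ∑ j ∈ C with P i j ∧ cl j = s,
          β j • ∑ i' ∈ R with P i' j ∧ cl j = s, X s i') (v j₀)| ≤ 9 / 7 * ε := by
        rw [real_inner_smul_left, sum_inner, abs_mul, abs_of_nonneg (hα0 i)]
        have h1 : |∑ j ∈ C with P i j ∧ cl j = s, inner ℝ (β j • ∑ i' ∈ R with P i' j ∧ cl j = s,
            X s i') (v j₀)| ≤ ∑ j ∈ C with P i j ∧ cl j = s, ω j * (9 / 7 * ε) :=
          (abs_sum_le_sum_abs _ _).trans (sum_le_sum fun j hj =>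
            ht j (mem_filter.1 hj).1 (mem_filter.1 hj).2)
        rw [← sum_mul] at h1
        have h2 := mul_le_mul_of_nonneg_left h1 (hα0 i)
        have h3 := mul_le_mul_of_nonneg_right (hαω i hi s) (by positivity : 0 ≤ 9 / 7 * ε)
        linarith
      have h0 := ih' i hi
      rw [hε1]
      rw [hsucc, inner_sub_left]
      rw [abs_le] at h0 hcorr ⊢
      constructor <;> linarith [h0.1, h0.2, hcorr.1, hcorr.2]
  -- conclusion
  have hsig : ∀ j ∈ C, ((#{i ∈ R | P i j} : ℝ) / 2) ^ 2 ≤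
      ‖∑ i ∈ R with P i j, X (cl j) i‖ ^ 2 * Bv := by
    intro j hj
    have h1 : (#{i ∈ R | P i j} : ℝ) / 2 ≤ inner ℝ (∑ i ∈ R with P i j, X (cl j) i) (v j) := by
      rw [sum_inner, div_eq_mul_inv, ← nsmul_eq_mul, ← sum_const]
      refine sum_le_sum fun i hi => ?_
      have hi' := mem_filter.1 hi
      -- When the layer of `j` is reached the error is at most `2 / 7 < 1 / 2`, so each neighbour
      -- still contributes at least `1 / 2`.
      have h2 := hclose j hj ⟨i, hi'⟩ (cl j) le_rfl i hi'.1
      rw [if_pos (hPE _ _ hi'.2), Nat.sub_self, pow_zero, abs_le] at h2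
      linarith [h2.1]
    have h2 := h1.trans (real_inner_le_norm _ _)
    have h3 := pow_le_pow_left₀ (by positivity) h2 2
    rw [mul_pow] at h3
    exact h3.trans (mul_le_mul_of_nonneg_left (hv j hj) (by positivity))
  have hcs : (∑ j ∈ C, ω j * ((#{i ∈ R | P i j} : ℝ) / 2)) ^ 2 ≤
      (∑ j ∈ C, β j * ‖∑ i ∈ R with P i j, X (cl j) i‖ ^ 2) *
        ∑ j ∈ C, ω j * colDeg E R j * Bv := by
    refine sum_sq_le_sum_mul_sum_of_sq_le_mul _ (fun j hj => mul_nonneg (hβ0 j hj) (by positivity))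
      (fun j hj => ?_) fun j hj => ?_
    · have := hω j hj
      have := (sq_nonneg _).trans (hv j hj)
      positivity
    · have hw := hω j hj
      by_cases h : (colDeg E R j : ℝ) = 0
      · have : #{i ∈ R | P i j} = 0 := by
          have := hnd j
          have h' : colDeg E R j = 0 := by exact_mod_cast h
          omega
        rw [this, h]; simp
      · calc (ω j * ((#{i ∈ R | P i j} : ℝ) / 2)) ^ 2 = ω j ^ 2 * ((#{i ∈ R | P i j} : ℝ) / 2) ^ 2 := by
              ring
          _ ≤ ω j ^ 2 * (‖∑ i ∈ R with P i j, X (cl j) i‖ ^ 2 * Bv) := by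
              have := hsig j hj
              gcongr
          _ = _ := by simp only [hβ]; field_simp
  have hμ : ∑ i ∈ R, ∑ j ∈ C with P i j, ω j =
      2 * ∑ j ∈ C, ω j * ((#{i ∈ R | P i j} : ℝ) / 2) := by
    rw [sum_filter_swap, mul_sum]
    refine sum_congr rfl fun j _ => ?_
    rw [sum_const, nsmul_eq_mul]; ring
  rw [← sum_mul] at hcs
  by_cases hC : C.Nonempty
  · obtain ⟨j, hj⟩ := hC
    have hBv : 0 ≤ Bv := (sq_nonneg _).trans (hv j hj)
    have hF0 : 0 ≤ F := sum_nonneg fun j hj => mul_nonneg (hω j hj).le (by positivity)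
    have := mul_le_mul_of_nonneg_right henergy (mul_nonneg hF0 hBv)
    rw [hμ]
    change _ ≤ _ at hcs
    nlinarith
  · rw [not_nonempty_iff_eq_empty.1 hC]; simp [hF, not_nonempty_iff_eq_empty.1 hC]

end Concentration

/-! ### Concentration of rows on degree classes -/

section DegreeClasses

variable {ι κ H : Type*} [NormedAddCommGroup H] [InnerProductSpace ℝ H]

/-- An edge `(i, j)` is spread if less than a fraction `θ` of the weight of the row `i` lies on
columns whose degree is comparable to that of `j`. -/
def Spread (E : ι → κ → Prop) (R : Finset ι) (C : Finset κ) (ω : κ → ℝ) (θ : ℝ) (i : ι) (j : κ) :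
    Prop :=
  E i j ∧ ∑ j' ∈ C with E i j' ∧ Nat.log 8 (colDeg E R j') = Nat.log 8 (colDeg E R j), ω j' ≤
    θ * ∑ j' ∈ C with E i j', ω j'

/-- Restricting to one parity separates the classes: if the logarithms differ by `2 * k` with `k ≥
1`, the degrees differ by a factor above `8 ^ (2 * k - 1) ≥ 8 ^ k`. The layer index `m - b / 2` puts
large degrees first, and `1600` makes `4 * Bu * Bv * θ` at most `(1 / 20) ^ 2`. -/
lemma spread_weight_parity_le {R : Finset ι} {C : Finset κ} {E : ι → κ → Prop} {u : ι → H}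
    {v : κ → H} {ω : κ → ℝ} {θ Bu Bv : ℝ} (hθ : 0 < θ) (hω : ∀ j ∈ C, 0 < ω j)
    (huv : ∀ i ∈ R, ∀ j ∈ C, inner ℝ (u i) (v j) = if E i j then 1 else 0)
    (hu : ∀ i ∈ R, ‖u i‖ ^ 2 ≤ Bu) (hv : ∀ j ∈ C, ‖v j‖ ^ 2 ≤ Bv)
    (hB : 1600 * (Bu * Bv * θ) ≤ 1) (p : ℕ) :
    ∑ i ∈ R, ∑ j ∈ C with Spread E R C ω θ i j ∧ Nat.log 8 (colDeg E R j) % 2 = p, ω j ≤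
      (∑ j ∈ C, ω j * colDeg E R j) / 20 := by
  set b : κ → ℕ := fun j => Nat.log 8 (colDeg E R j) with hb
  set m := C.sup b
  have hm : ∀ j ∈ C, b j ≤ m := fun j hj => le_sup hj
  set F := ∑ j ∈ C, ω j * colDeg E R j with hF
  have hF0 : 0 ≤ F := sum_nonneg fun j hj => mul_nonneg (hω j hj).le (by positivity)
  have key := spread_weight_sq_le (R := R) (C := C) (E := E)
    (P := fun i j => Spread E R C ω θ i j ∧ b j % 2 = p) (cl := fun j => m - b j / 2)
    hθ hω (fun i j h => h.1.1) huv hu hv ?_ ?_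
  · refine le_of_sq_le_sq ?_ (by positivity)
    refine key.trans ?_
    have := mul_le_mul_of_nonneg_right hB (sq_nonneg F)
    rw [← hF]
    linarith
  · rintro j hj j' hj' ⟨i, hi, h⟩ ⟨i', hi', h'⟩ hlt
    have h1 := hm j hj
    have h2 := hm j' hj'
    have h3 : b j % 2 = p := h.2
    have h4 : b j' % 2 = p := h'.2
    obtain ⟨k, hk⟩ : ∃ k, k = (m - b j' / 2) - (m - b j / 2) := ⟨_, rfl⟩
    have h5 : b j' + 1 + k ≤ b j := by omega
    change _ * 8 ^ ((m - b j' / 2) - (m - b j / 2)) ≤ _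
    rw [← hk]
    have h6 : colDeg E R j' < 8 ^ (b j' + 1) := Nat.lt_pow_succ_log_self (by norm_num) _
    have h7 : 8 ^ b j ≤ colDeg E R j := by
      refine Nat.pow_log_le_self 8 ?_
      exact (card_pos.2 ⟨i, by simp [hi, h.1.1]⟩).ne'
    calc colDeg E R j' * 8 ^ k ≤ 8 ^ (b j' + 1) * 8 ^ k := Nat.mul_le_mul_right _ h6.le
      _ = 8 ^ (b j' + 1 + k) := (pow_add _ _ _).symm
      _ ≤ 8 ^ b j := Nat.pow_le_pow_right (by norm_num) h5
      _ ≤ _ := h7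
  · intro i hi s
    have hD0 : 0 ≤ θ * ∑ j ∈ C with E i j, ω j :=
      mul_nonneg hθ.le (sum_nonneg fun j hj => (hω j (mem_filter.1 hj).1).le)
    by_cases hne : ∃ j ∈ C, (Spread E R C ω θ i j ∧ b j % 2 = p) ∧ m - b j / 2 = s
    · obtain ⟨j, hj, ⟨⟨h1, h2⟩, h3⟩, h4⟩ := hne
      refine le_trans (sum_le_sum_of_subset_of_nonneg (fun j' hj' => ?_) fun j' hj' _ => ?_) h2
      · simp only [mem_filter] at hj' ⊢
        obtain ⟨h5, ⟨⟨h6, -⟩, h7⟩, h8⟩ := hj'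
        have := hm j hj
        have := hm j' h5
        exact ⟨h5, h6, show b j' = b j by omega⟩
      · exact (hω j' (mem_filter.1 hj').1).le
    · refine le_of_eq_of_le (sum_eq_zero fun j hj => ?_) hD0
      exact absurd ⟨j, mem_filter.1 hj⟩ hne

/-- Most of the weighted edges `(i, j)` are such that a fixed proportion of the weight of `i` lies
on columns whose degree is comparable to that of `j`. -/
lemma spread_weight_le {R : Finset ι} {C : Finset κ} {E : ι → κ → Prop} {u : ι → H}
    {v : κ → H} {ω : κ → ℝ} {θ Bu Bv : ℝ} (hθ : 0 < θ) (hω : ∀ j ∈ C, 0 < ω j)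
    (huv : ∀ i ∈ R, ∀ j ∈ C, inner ℝ (u i) (v j) = if E i j then 1 else 0)
    (hu : ∀ i ∈ R, ‖u i‖ ^ 2 ≤ Bu) (hv : ∀ j ∈ C, ‖v j‖ ^ 2 ≤ Bv)
    (hB : 1600 * (Bu * Bv * θ) ≤ 1) :
    ∑ i ∈ R, ∑ j ∈ C with Spread E R C ω θ i j, ω j ≤
      (∑ j ∈ C, ω j * colDeg E R j) / 10 := by
  have h0 := spread_weight_parity_le hθ hω huv hu hv hB 0
  have h1 := spread_weight_parity_le hθ hω huv hu hv hB 1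
  have h2 := add_le_add h0 h1
  rw [← sum_add_distrib] at h2
  refine le_trans (sum_le_sum fun i _ => ?_) (h2.trans (by linarith))
  rw [← sum_filter_add_sum_filter_not (C.filter fun j => Spread E R C ω θ i j)
    (fun j => Nat.log 8 (colDeg E R j) % 2 = 0), filter_filter, filter_filter]
  simp only [Nat.mod_two_not_eq_zero, le_refl]

end DegreeClasses

/-! ### Many 4-cycles in nearly regular graphs -/

section FourCycles

variable {ι κ H : Type*} [NormedAddCommGroup H] [InnerProductSpace ℝ H]

/-- The iterates of `X ↦ X - c • A Aᵀ X`, where `A` is the biadjacency matrix of `E`. -/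
noncomputable def diffuse (E : ι → κ → Prop) (R : Finset ι) (C : Finset κ) (c : ℝ) (u : ι → H) :
    ℕ → ι → H
  | 0 => u
  | s + 1 => fun i => diffuse E R C c u s i -
      c • ∑ j ∈ C with E i j, ∑ i' ∈ R with E i' j, diffuse E R C c u s i'

lemma diffuse_energy {R : Finset ι} {C : Finset κ} {E : ι → κ → Prop} {c : ℝ} {a b : ℕ}
    (hc : 0 ≤ c) (hcab : c * (a * b) ≤ 1) (ha : ∀ i ∈ R, rowDeg E C i ≤ a)
    (hb : ∀ j ∈ C, colDeg E R j ≤ b) (X : ι → H) :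
    ∑ i ∈ R, ‖X i - c • ∑ j ∈ C with E i j, ∑ i' ∈ R with E i' j, X i'‖ ^ 2 +
      c * ∑ j ∈ C, ‖∑ i ∈ R with E i j, X i‖ ^ 2 ≤ ∑ i ∈ R, ‖X i‖ ^ 2 := by
  have := energy_decrement (R := R) (C := C) (P := E) (X := X)
    (Y := fun j => ∑ i ∈ R with E i j, X i) (ρ := fun _ => 1) (α := fun _ => c) (β := fun _ => 1)
    (γ := fun _ => b) (c := c) hc (fun _ _ => hc) (fun _ _ => zero_le_one) (fun _ _ => rfl)
    (fun _ _ _ _ _ => one_mul c) (fun i hi => ?_) (fun j hj => ?_)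
  · simpa only [one_mul, one_smul] using this
  · rw [sum_const, nsmul_eq_mul]
    refine le_trans ?_ hcab
    have h : (#{j ∈ C | E i j} : ℝ) ≤ a := by exact_mod_cast ha i hi
    gcongr
  · rw [mul_one]; exact_mod_cast hb j hj

/-- The left side counts closed walks of length four. The right side is the squared Frobenius norm
of `Aᵀ A`, the form that the diffusion argument controls. -/
lemma sum_edgeCount_common (E : ι → κ → Prop) (R : Finset ι) (C : Finset κ) :
    ((∑ j ∈ C, ∑ i ∈ R with E i j,
      edgeCount E (R.filter fun i' => E i' j) (C.filter fun j' => E i j') : ℕ) : ℝ) =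
      ∑ j ∈ C, ∑ j' ∈ C, (∑ i ∈ R with E i j, if E i j' then (1 : ℝ) else 0) ^ 2 := by
  push_cast [edgeCount, rowDeg]
  refine sum_congr rfl fun j _ => ?_
  have h : ∀ i i' : ι, ((#{j' ∈ C.filter fun j' => E i j' | E i' j'} : ℕ) : ℝ) =
      ∑ j' ∈ C, (if E i j' then (1 : ℝ) else 0) * (if E i' j' then (1 : ℝ) else 0) := by
    intro i i'
    rw [filter_filter, card_filter]
    push_cast
    refine sum_congr rfl fun j' _ => ?_
    by_cases h1 : E i j' <;> by_cases h2 : E i' j' <;> simp [h1, h2]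
  simp only [h, sq, sum_mul_sum]
  rw [sum_comm (s := C)]
  refine sum_congr rfl fun i _ => ?_
  rw [sum_comm (s := C)]

set_option maxHeartbeats 1000000 in
/-- A nearly regular bipartite graph with bounded factorization norm has an edge `i ∼ j` with many
edges between the neighbourhoods of `j` and of `i`. -/
lemma exists_edge_dense_neighbourhoods {R : Finset ι} {C : Finset κ} {E : ι → κ → Prop} {u : ι → H}
    {v : κ → H} {L a b G : ℕ} (hL : 0 < L) (hG : 0 < G) (hab : 0 < a * b)
    (huv : ∀ i ∈ R, ∀ j ∈ C, inner ℝ (u i) (v j) = if E i j then 1 else 0)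
    (hu : ∀ i ∈ R, ‖u i‖ ^ 2 ≤ L) (hv : ∀ j ∈ C, ‖v j‖ ^ 2 ≤ L)
    (ha : ∀ i ∈ R, rowDeg E C i ≤ a) (hb : ∀ j ∈ C, colDeg E R j ≤ b)
    (hR : #R * a ≤ G * edgeCount E R C) (hC : #C * b ≤ G * edgeCount E R C)
    (he : 0 < edgeCount E R C) :
    ∃ i ∈ R, ∃ j ∈ C, E i j ∧ a * b ≤ 8 * L ^ 2 * G ^ 2 *
      edgeCount E (R.filter fun i' => E i' j) (C.filter fun j' => E i j') := by
  by_contra hcon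
  push Not at hcon
  set e : ℝ := ((edgeCount E R C : ℕ) : ℝ) with hedef
  have he' : 0 < e := by rw [hedef]; exact_mod_cast he
  have hab' : (0 : ℝ) < a * b := by exact_mod_cast hab
  set c : ℝ := 1 / (a * b) with hcdef
  have hc : 0 < c := by positivity
  have hcab : c * (a * b) = 1 := one_div_mul_cancel hab'.ne'
  set X := diffuse E R C c u with hX
  set Y : ℕ → κ → H := fun s j => ∑ i ∈ R with E i j, X s i with hY
  have hX0 : X 0 = u := rfl
  have hXs : ∀ s i, X (s + 1) i = X s i - c • ∑ j ∈ C with E i j, Y s j := fun _ _ => rfl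
  clear_value X
  -- On `C`, `T 0` is the matrix `M = Aᵀ A`, and `T (s + 1) = (1 - c M) T s`. The signal is the
  -- trace of `T s`, which starts at the number of edges, and `Q` is the squared Frobenius norm of
  -- `M`.
  set T : ℕ → κ → κ → ℝ := fun s j j' => inner ℝ (Y s j) (v j') with hT
  set Q : ℝ := ∑ j ∈ C, ∑ j' ∈ C, T 0 j j' ^ 2 with hQ
  have hM : ∀ j, ∀ j' ∈ C, T 0 j j' = ∑ i ∈ R with E i j, if E i j' then (1 : ℝ) else 0 := by
    intro j j' hj'
    simp only [hT, hY, hX0, sum_inner]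
    exact sum_congr rfl fun i hi => huv i (mem_filter.1 hi).1 j' hj'
  -- few closed quadruples
  have hQlt : 8 * L ^ 2 * G ^ 2 * Q < e * (a * b) := by
    have h1 : Q = ((∑ j ∈ C, ∑ i ∈ R with E i j,
        edgeCount E (R.filter fun i' => E i' j) (C.filter fun j' => E i j') : ℕ) : ℝ) := by
      rw [sum_edgeCount_common, hQ]
      exact sum_congr rfl fun j _ => sum_congr rfl fun j' hj' => by rw [hM j j' hj']
    rw [h1, hedef, edgeCount_eq_sum_colDeg]
    have h2 : 8 * L ^ 2 * G ^ 2 * ∑ j ∈ C, ∑ i ∈ R with E i j,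
        edgeCount E (R.filter fun i' => E i' j) (C.filter fun j' => E i j') <
        (∑ j ∈ C, colDeg E R j) * (a * b) := by
      simp only [mul_sum, sum_mul]
      rw [edgeCount_eq_sum_colDeg] at he
      have h3 : ∀ j ∈ C, ∑ i ∈ R with E i j, 8 * L ^ 2 * G ^ 2 *
          edgeCount E (R.filter fun i' => E i' j) (C.filter fun j' => E i j') ≤
          colDeg E R j * (a * b) := by
        intro j hj
        rw [colDeg, ← smul_eq_mul (a := #_), ← sum_const]
        refine sum_le_sum fun i hi => ?_
        exact (hcon i (mem_filter.1 hi).1 j hj (mem_filter.1 hi).2).le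
      refine sum_lt_sum h3 ?_
      obtain ⟨j, hj, hj0⟩ := exists_ne_zero_of_sum_ne_zero he.ne'
      refine ⟨j, hj, ?_⟩
      rw [colDeg, ← smul_eq_mul (a := #_), ← sum_const]
      refine sum_lt_sum_of_nonempty (card_pos.1 (Nat.pos_of_ne_zero hj0)) fun i hi => ?_
      exact hcon i (mem_filter.1 hi).1 j hj (mem_filter.1 hi).2
    exact_mod_cast h2
  -- energy
  have htot : ∀ S, ∑ i ∈ R, ‖X S i‖ ^ 2 + ∑ s ∈ range S, c * ∑ j ∈ C, ‖Y s j‖ ^ 2 ≤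
      ∑ i ∈ R, ‖u i‖ ^ 2 := by
    intro S
    induction S with
    | zero => simp [hX0]
    | succ S ih =>
      rw [sum_range_succ]
      have := diffuse_energy hc.le hcab.le ha hb (X S)
      simp only [hXs]
      linarith
  have henergy : ∀ S, ∑ s ∈ range S, ∑ j ∈ C, ‖Y s j‖ ^ 2 ≤ a * b * (L * #R) := by
    intro S
    have h1 := htot S
    have h2 : ∑ i ∈ R, ‖u i‖ ^ 2 ≤ L * #R := by
      rw [mul_comm, ← nsmul_eq_mul, ← sum_const]; exact sum_le_sum hu
    have h3 : 0 ≤ ∑ i ∈ R, ‖X S i‖ ^ 2 := sum_nonneg fun _ _ => by positivity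
    rw [← mul_sum, hcdef, one_div_mul_eq_div] at h1
    have h4 : (∑ s ∈ range S, ∑ j ∈ C, ‖Y s j‖ ^ 2) / (a * b) ≤ L * #R := by linarith
    rw [div_le_iff₀ hab'] at h4
    linarith
  -- the signal
  have hTs : ∀ s j j', T (s + 1) j j' =
      T s j j' - c * ∑ i ∈ R with E i j, ∑ j'' ∈ C with E i j'', T s j'' j' := by
    intro s j j'
    simp only [hT]
    have : Y (s + 1) j = Y s j - c • ∑ i ∈ R with E i j, ∑ j'' ∈ C with E i j'', Y s j'' := by
      rw [show Y (s + 1) j = ∑ i ∈ R with E i j, X (s + 1) i from rfl]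
      simp only [hXs, sum_sub_distrib, ← smul_sum]
      rfl
    rw [this, inner_sub_left, real_inner_smul_left, sum_inner]
    simp only [sum_inner]
  -- `1 - c M` is a contraction: this is `diffuse_energy` for the transposed graph, applied to the
  -- scalar columns of `T s`.
  have hcontr : ∀ s, ∀ j' ∈ C, ∑ j ∈ C, T s j j' ^ 2 ≤ ∑ j ∈ C, T 0 j j' ^ 2 := by
    intro s j' hj'
    induction s with
    | zero => exact le_rfl
    | succ s ih =>
      refine le_trans ?_ ih
      have := diffuse_energy (E := fun j i => E i j) hc.le
        (by rw [mul_comm (b : ℝ)]; exact hcab.le) hb ha (fun j => T s j j')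
      simp only [smul_eq_mul, Real.norm_eq_abs, sq_abs, ← hTs] at this
      have h2 : 0 ≤ c * ∑ i ∈ R, (∑ j ∈ C with E i j, T s j j') ^ 2 :=
        mul_nonneg hc.le (sum_nonneg fun _ _ => sq_nonneg _)
      linarith
  -- One step lowers the trace by `c` times the Frobenius product of `M` and `T s`, hence by at most
  -- `c * Q`.
  have hsig : ∀ s : ℕ, e - s * (c * Q) ≤ ∑ j ∈ C, T s j j := by
    intro s
    induction s with
    | zero =>
      rw [hedef, edgeCount_eq_sum_colDeg]
      push_cast
      rw [zero_mul, sub_zero]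
      refine sum_le_sum fun j hj => ?_
      rw [hM j j hj, sum_congr rfl fun i hi => if_pos (mem_filter.1 hi).2, sum_const, nsmul_eq_mul,
        mul_one]
      rfl
    | succ s ih =>
      have h1 : ∑ j ∈ C, ∑ i ∈ R with E i j, ∑ j'' ∈ C with E i j'', T s j'' j ≤ Q := by
        have h2 : ∀ j ∈ C, ∑ i ∈ R with E i j, ∑ j'' ∈ C with E i j'', T s j'' j ≤
            ∑ j'' ∈ C, T 0 j'' j ^ 2 := by
          intro j hj
          have h3 : ∑ i ∈ R with E i j, ∑ j'' ∈ C with E i j'', T s j'' j =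
              ∑ j'' ∈ C, T 0 j'' j * T s j'' j := by
            simp only [hM _ j hj, sum_mul, sum_filter (s := C)]
            rw [sum_comm]
            refine sum_congr rfl fun j'' _ => ?_
            rw [sum_filter, sum_filter]
            refine sum_congr rfl fun i _ => ?_
            by_cases h1 : E i j <;> by_cases h2 : E i j'' <;> simp [h1, h2]
          rw [h3]
          have h4 := hcontr s j hj
          have h5 : ∑ j'' ∈ C, T 0 j'' j * T s j'' j ≤
              ∑ j'' ∈ C, (T 0 j'' j ^ 2 + T s j'' j ^ 2) / 2 :=
            sum_le_sum fun j'' _ => by nlinarith [sq_nonneg (T 0 j'' j - T s j'' j)]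
          rw [← sum_div, sum_add_distrib] at h5
          linarith
        rw [hQ, sum_comm]
        exact sum_le_sum h2
      simp only [hTs, sum_sub_distrib, ← mul_sum]
      have := mul_le_mul_of_nonneg_left h1 hc.le
      push_cast
      linarith
  -- conclusion
  set S : ℕ := 4 * L ^ 2 * G ^ 2 with hS
  have hlow : S * (e - S * (c * Q)) ≤ ∑ s ∈ range S, ∑ j ∈ C, T s j j := by
    have : ∑ s ∈ range S, (e - S * (c * Q)) ≤ ∑ s ∈ range S, ∑ j ∈ C, T s j j := by
      refine sum_le_sum fun s hs => le_trans ?_ (hsig s)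
      have h1 : (s : ℝ) ≤ S := by exact_mod_cast (mem_range.1 hs).le
      have h2 : 0 ≤ Q := sum_nonneg fun _ _ => sum_nonneg fun _ _ => sq_nonneg _
      gcongr
    rwa [sum_const, card_range, nsmul_eq_mul] at this
  -- Cauchy–Schwarz with the energy bound gives `S * L ^ 2 * G ^ 2 * e ^ 2`, and `S = 4 * L ^ 2 * G
  -- ^ 2` is chosen to turn this into `(S * e / 2) ^ 2`. The mean signal is thus at most `e / 2`,
  -- whereas `hQlt` keeps it above.
  have hup : (∑ s ∈ range S, ∑ j ∈ C, T s j j) ^ 2 ≤ (S * e / 2) ^ 2 := by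
    rw [← sum_product']
    have h1 : (∑ x ∈ range S ×ˢ C, T x.1 x.2 x.2) ^ 2 ≤
        (∑ x ∈ range S ×ˢ C, ‖Y x.1 x.2‖ ^ 2) * ∑ x ∈ range S ×ˢ C, (L : ℝ) := by
      refine sum_sq_le_sum_mul_sum_of_sq_le_mul _ (fun _ _ => by positivity)
        (fun _ _ => by positivity) fun x hx => ?_
      have hxC := (mem_product.1 hx).2
      have h2 : T x.1 x.2 x.2 ^ 2 ≤ (‖Y x.1 x.2‖ * ‖v x.2‖) ^ 2 :=
        sq_le_sq' (by linarith [neg_le_of_abs_le (abs_real_inner_le_norm (Y x.1 x.2) (v x.2))])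
          (real_inner_le_norm _ _)
      refine h2.trans ?_
      rw [mul_pow]
      exact mul_le_mul_of_nonneg_left (hv _ hxC) (by positivity)
    rw [sum_product' (f := fun s j => ‖Y s j‖ ^ 2), sum_const, nsmul_eq_mul, card_product,
      card_range] at h1
    have h3 := henergy S
    have hR' : (#R : ℝ) * a ≤ G * e := by rw [hedef]; exact_mod_cast hR
    have hC' : (#C : ℝ) * b ≤ G * e := by rw [hedef]; exact_mod_cast hC
    have h4 := mul_le_mul hR' hC' (by positivity) (by positivity)
    refine h1.trans ((mul_le_mul_of_nonneg_right h3 (by positivity)).trans ?_)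
    have h5 : (S : ℝ) = 4 * L ^ 2 * G ^ 2 := by rw [hS]; push_cast; ring
    push_cast
    calc (a : ℝ) * b * (L * #R) * (S * #C * L) = S * L ^ 2 * (#R * a * (#C * b)) := by ring
      _ ≤ S * L ^ 2 * (G * e * (G * e)) := by gcongr
      _ = (S * e / 2) ^ 2 := by rw [h5]; ring
  have hup' := le_of_sq_le_sq hup (by positivity)
  have hSpos : (0 : ℝ) < S := by
    have : 0 < S := by positivity
    exact_mod_cast this
  have h1 : e - S * (c * Q) ≤ e / 2 := by
    have := hlow.trans hup'
    have h2 : S * (e - S * (c * Q)) ≤ S * (e / 2) := by linarith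
    exact le_of_mul_le_mul_left h2 hSpos
  have h2 : c * Q * (2 * S) < e := by
    have h5 : (S : ℝ) = 4 * L ^ 2 * G ^ 2 := by rw [hS]; push_cast; ring
    have h3 := mul_lt_mul_of_pos_left hQlt hc
    rw [h5]
    calc c * Q * (2 * (4 * L ^ 2 * G ^ 2)) = c * (8 * L ^ 2 * G ^ 2 * Q) := by ring
      _ < c * (e * (a * b)) := h3
      _ = e * (c * (a * b)) := by ring
      _ = e := by rw [hcab, mul_one]
  linarith

end FourCycles

/-! ### A nearly regular block -/

section Blocks

variable {ι κ H : Type*} [NormedAddCommGroup H] [InnerProductSpace ℝ H]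

lemma edgeCount_flip (E : ι → κ → Prop) (R : Finset ι) (C : Finset κ) :
    edgeCount (fun j i => E i j) C R = edgeCount E R C :=
  (edgeCount_eq_sum_colDeg E R C).symm

/-- The rows of degree about `8 ^ a` having a fraction at least `θ` of their edges towards columns
of degree about `8 ^ b`. -/
noncomputable def concRows (E : ι → κ → Prop) (R : Finset ι) (C : Finset κ) (θ : ℝ) (a b : ℕ) :
    Finset ι :=
  {i ∈ R | Nat.log 8 (rowDeg E C i) = a ∧
    θ * rowDeg E C i < #{j ∈ C | E i j ∧ Nat.log 8 (colDeg E R j) = b}}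

/-- The class `a` is determined by the row, and edges towards different column classes `b` are
distinct, so the edges certifying membership in `concRows` are never counted twice. -/
lemma sum_concRows_le (E : ι → κ → Prop) (R : Finset ι) (C : Finset κ) (θ : ℝ) (A B : Finset ℕ) :
    ∑ a ∈ A, ∑ b ∈ B, ∑ i ∈ concRows E R C θ a b, θ * rowDeg E C i ≤ edgeCount E R C := by
  have h1 : ∀ a ∈ A, ∀ b ∈ B, ∑ i ∈ concRows E R C θ a b, θ * rowDeg E C i ≤
      ∑ i ∈ R with Nat.log 8 (rowDeg E C i) = a,
        (#{j ∈ C | E i j ∧ Nat.log 8 (colDeg E R j) = b} : ℝ) := by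
    intro a _ b _
    refine (sum_le_sum fun i hi => (mem_filter.1 hi).2.2.le).trans ?_
    refine sum_le_sum_of_subset_of_nonneg (fun i hi => ?_) fun _ _ _ => by positivity
    have := mem_filter.1 hi
    exact mem_filter.2 ⟨this.1, this.2.1⟩
  refine (sum_le_sum fun a ha => sum_le_sum fun b hb => h1 a ha b hb).trans ?_
  have h2 : ∀ a ∈ A, ∑ b ∈ B, ∑ i ∈ R with Nat.log 8 (rowDeg E C i) = a,
      (#{j ∈ C | E i j ∧ Nat.log 8 (colDeg E R j) = b} : ℝ) ≤
      ∑ i ∈ R with Nat.log 8 (rowDeg E C i) = a, (rowDeg E C i : ℝ) := by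
    intro a _
    rw [sum_comm]
    refine sum_le_sum fun i _ => ?_
    have : ∑ b ∈ B, #{j ∈ C | E i j ∧ Nat.log 8 (colDeg E R j) = b} ≤ rowDeg E C i := by
      simp only [← filter_filter, card_eq_sum_ones, rowDeg]
      exact sum_fiberwise_le_sum_of_sum_fiber_nonneg fun _ _ => Nat.zero_le _
    exact_mod_cast this
  refine (sum_le_sum h2).trans ?_
  rw [edgeCount]
  push_cast
  exact sum_fiberwise_le_sum_of_sum_fiber_nonneg fun _ _ => sum_nonneg fun _ _ => Nat.cast_nonneg _

/-- A graph with bounded factorization norm contains a nearly regular block in which the rows and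
the columns keep a fixed proportion of their degrees. -/
lemma exists_regular_block {R : Finset ι} {C : Finset κ} {E : ι → κ → Prop} {u : ι → H}
    {v : κ → H} {L : ℕ} (hL : 0 < L)
    (huv : ∀ i ∈ R, ∀ j ∈ C, inner ℝ (u i) (v j) = if E i j then 1 else 0)
    (hu : ∀ i ∈ R, ‖u i‖ ^ 2 ≤ L) (hv : ∀ j ∈ C, ‖v j‖ ^ 2 ≤ L) (he : 0 < edgeCount E R C) :
    ∃ R' ⊆ R, ∃ C' ⊆ C, ∃ a b : ℕ, 0 < a * b ∧ (∀ i ∈ R', rowDeg E C i ≤ a) ∧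
      (∀ j ∈ C', colDeg E R j ≤ b) ∧ #R' * a ≤ 38400 * L ^ 2 * edgeCount E R' C' ∧
      #C' * b ≤ 38400 * L ^ 2 * edgeCount E R' C' ∧ 0 < edgeCount E R' C' := by
  set θ : ℝ := 1 / (1600 * L ^ 2) with hθdef
  have hL' : (0 : ℝ) < L := by exact_mod_cast hL
  have hθ : 0 < θ := by positivity
  have hB : 1600 * ((L : ℝ) * L * θ) ≤ 1 := le_of_eq (by rw [hθdef]; field_simp)
  set e : ℝ := ((edgeCount E R C : ℕ) : ℝ) with hedef
  have he' : 0 < e := by rw [hedef]; exact_mod_cast he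
  set E' : κ → ι → Prop := fun j i => E i j with hE'
  set SR : ι → κ → Prop := Spread E R C (fun _ => 1) θ with hSR
  set SC : κ → ι → Prop := Spread E' C R (fun _ => 1) θ with hSC
  have hrow : ∑ i ∈ R, ∑ j ∈ C with SR i j, (1 : ℝ) ≤ e / 10 := by
    have := spread_weight_le hθ (fun _ _ => zero_lt_one) huv hu hv hB
    simp only [one_mul] at this
    rwa [← Nat.cast_sum, ← edgeCount_eq_sum_colDeg] at this
  have hcol : ∑ j ∈ C, ∑ i ∈ R with SC j i, (1 : ℝ) ≤ e / 10 := by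
    have := spread_weight_le (E := E') (R := C) (C := R) (u := v) (v := u) hθ
      (fun _ _ => zero_lt_one)
      (fun j hj i hi => by rw [real_inner_comm]; exact huv i hi j hj) hv hu hB
    simp only [one_mul] at this
    rwa [← Nat.cast_sum, ← edgeCount_eq_sum_colDeg, edgeCount_flip] at this
  rw [← sum_filter_swap (fun i j => SC j i) R C] at hcol
  set ra : ι → ℕ := fun i => Nat.log 8 (rowDeg E C i) with hra
  set cb : κ → ℕ := fun j => Nat.log 8 (colDeg E R j) with hcb
  set R' : ℕ → ℕ → Finset ι := fun a b => concRows E R C θ a b with hR'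
  set C' : ℕ → ℕ → Finset κ := fun a b => concRows E' C R θ b a with hC'
  set A := R.image ra with hA
  set B := C.image cb with hBdef
  -- most edges lie in one of the blocks
  have hmany : e * (8 / 10) ≤ ∑ a ∈ A, ∑ b ∈ B, (edgeCount E (R' a b) (C' a b) : ℝ) := by
    have h1 : ∀ i ∈ R, ∀ j ∈ C, (if E i j then (1 : ℝ) else 0) ≤ (if SR i j then (1 : ℝ) else 0) +
        (if SC j i then (1 : ℝ) else 0) +
        ∑ a ∈ A, ∑ b ∈ B, if i ∈ R' a b ∧ j ∈ C' a b ∧ E i j then (1 : ℝ) else 0 := by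
      intro i hi j hj
      have h0 : 0 ≤ ∑ a ∈ A, ∑ b ∈ B, if i ∈ R' a b ∧ j ∈ C' a b ∧ E i j then (1 : ℝ) else 0 :=
        sum_nonneg fun _ _ => sum_nonneg fun _ _ => by split_ifs <;> simp
      by_cases h1 : E i j
      swap
      · rw [if_neg h1]; split_ifs <;> linarith
      by_cases h2 : SR i j
      · rw [if_pos h1, if_pos h2]; split_ifs <;> linarith
      by_cases h3 : SC j i
      · rw [if_pos h1, if_pos h3, if_neg h2]; linarith
      rw [if_pos h1, if_neg h2, if_neg h3, zero_add, zero_add]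
      have h4 : i ∈ R' (ra i) (cb j) := by
        refine mem_filter.2 ⟨hi, rfl, ?_⟩
        by_contra h
        refine h2 ⟨h1, ?_⟩
        simpa [rowDeg] using h
      have h5 : j ∈ C' (ra i) (cb j) := by
        refine mem_filter.2 ⟨hj, rfl, ?_⟩
        by_contra h
        refine h3 ⟨h1, ?_⟩
        simpa [rowDeg, colDeg, hra, hE'] using h
      refine le_trans ?_ (single_le_sum (f := fun a => ∑ b ∈ B,
        if i ∈ R' a b ∧ j ∈ C' a b ∧ E i j then (1 : ℝ) else 0)
        (fun _ _ => sum_nonneg fun _ _ => by split_ifs <;> simp) (mem_image_of_mem ra hi))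
      refine le_trans ?_ (single_le_sum (f := fun b =>
        if i ∈ R' (ra i) b ∧ j ∈ C' (ra i) b ∧ E i j then (1 : ℝ) else 0)
        (fun _ _ => by split_ifs <;> simp) (mem_image_of_mem cb hj))
      simp only [h4, h5, h1, and_self, if_true, le_refl]
    have h2 := sum_le_sum fun i hi => sum_le_sum fun j hj => h1 i hi j hj
    simp only [sum_add_distrib] at h2
    have h3 : ∑ i ∈ R, ∑ j ∈ C, (if E i j then (1 : ℝ) else 0) = e := by
      rw [hedef, edgeCount]; push_cast
      exact sum_congr rfl fun i _ => by simp [rowDeg]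
    have h4 : ∑ i ∈ R, ∑ j ∈ C, ∑ a ∈ A, ∑ b ∈ B,
        (if i ∈ R' a b ∧ j ∈ C' a b ∧ E i j then (1 : ℝ) else 0) =
        ∑ a ∈ A, ∑ b ∈ B, (edgeCount E (R' a b) (C' a b) : ℝ) := by
      have h5 : ∀ a b, (edgeCount E (R' a b) (C' a b) : ℝ) = ∑ i ∈ R, ∑ j ∈ C,
          (if i ∈ R' a b ∧ j ∈ C' a b ∧ E i j then (1 : ℝ) else 0) := by
        intro a b
        have hs : R' a b ⊆ R := filter_subset _ _
        have hs' : C' a b ⊆ C := filter_subset _ _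
        rw [edgeCount]; push_cast
        rw [← inter_eq_right.2 hs, ← filter_mem_eq_inter, sum_filter]
        refine sum_congr rfl fun i _ => ?_
        by_cases hi : i ∈ R' a b
        · simp only [hi, if_true, rowDeg]
          rw [card_filter]; push_cast
          rw [← inter_eq_right.2 hs', ← filter_mem_eq_inter, sum_filter]
          refine sum_congr rfl fun j _ => ?_
          by_cases hj : j ∈ C' a b
          · simp [hj, hs hi, hs' hj, hi]
          · simp [hj]
        · simp [hi]
      simp only [h5]
      simp only [sum_comm (s := C) (t := A), sum_comm (s := R) (t := A)]
      refine sum_congr rfl fun a _ => ?_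
      simp only [sum_comm (s := C) (t := B), sum_comm (s := R) (t := B)]
    rw [h3, h4] at h2
    simp only [← sum_filter] at h2
    linarith
  have hRsum : ∑ a ∈ A, ∑ b ∈ B, ∑ i ∈ R' a b, θ * rowDeg E C i ≤ e := sum_concRows_le E R C θ A B
  have hCsum : ∑ a ∈ A, ∑ b ∈ B, ∑ j ∈ C' a b, θ * colDeg E R j ≤ e := by
    have := sum_concRows_le E' C R θ B A
    rw [edgeCount_flip, sum_comm] at this
    exact this
  -- Pigeonhole: over all blocks the left sides total at most `2 * e`, and the right sides at least
  -- `3 * (8 / 10) * e`.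
  obtain ⟨a, ha, b, hb, hab⟩ : ∃ a ∈ A, ∃ b ∈ B, (∑ i ∈ R' a b, θ * rowDeg E C i) +
      (∑ j ∈ C' a b, θ * colDeg E R j) < 3 * edgeCount E (R' a b) (C' a b) := by
    by_contra hcon
    push Not at hcon
    have h1 := sum_le_sum fun a ha => sum_le_sum fun b hb => hcon a ha b hb
    simp only [sum_add_distrib, ← mul_sum] at h1 hmany hRsum hCsum
    linarith
  have hnn1 : 0 ≤ ∑ i ∈ R' a b, θ * rowDeg E C i := sum_nonneg fun _ _ => by positivity
  have hnn2 : 0 ≤ ∑ j ∈ C' a b, θ * colDeg E R j := sum_nonneg fun _ _ => by positivity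
  have hpow : ∀ x d : ℕ, d ≠ 0 → Nat.log 8 d = x → d ≤ 8 ^ (x + 1) ∧ (8 : ℝ) ^ (x + 1) ≤ 8 * d := by
    rintro x d hd rfl
    refine ⟨(Nat.lt_pow_succ_log_self (by norm_num) _).le, ?_⟩
    have := Nat.pow_log_le_self 8 hd
    rw [pow_succ, mul_comm]
    have h2 : (8 : ℝ) ^ Nat.log 8 d ≤ d := by exact_mod_cast this
    linarith
  have hrowne : ∀ i ∈ R' a b, rowDeg E C i ≠ 0 := by
    intro i hi h
    have h1 := (mem_filter.1 hi).2.2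
    rw [h] at h1
    have h2 : #{j ∈ C | E i j ∧ Nat.log 8 (colDeg E R j) = b} ≤ rowDeg E C i :=
      card_le_card fun j hj => by simp only [mem_filter] at hj ⊢; tauto
    have h3 : #{j ∈ C | E i j ∧ Nat.log 8 (colDeg E R j) = b} = 0 := by omega
    rw [h3] at h1
    simp at h1
  have hcolne : ∀ j ∈ C' a b, colDeg E R j ≠ 0 := by
    intro j hj h
    have h1 := (mem_filter.1 hj).2.2
    change θ * (colDeg E R j : ℝ) < (#{i ∈ R | E i j ∧ Nat.log 8 (rowDeg E C i) = a} : ℝ) at h1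
    rw [h] at h1
    have h2 : #{i ∈ R | E i j ∧ Nat.log 8 (rowDeg E C i) = a} ≤ colDeg E R j :=
      card_le_card fun i hi => by simp only [mem_filter] at hi ⊢; tauto
    have h3 : #{i ∈ R | E i j ∧ Nat.log 8 (rowDeg E C i) = a} = 0 := by omega
    rw [h3] at h1
    simp at h1
  -- `38400 = 1600 * 3 * 8`: the constant of `1 / θ`, the pigeonhole factor, and the rounding of
  -- degrees up to a power of `8`.
  have hθL : θ * (38400 * L ^ 2) = 24 := by rw [hθdef]; field_simp; norm_num
  refine ⟨R' a b, filter_subset _ _, C' a b, filter_subset _ _, 8 ^ (a + 1), 8 ^ (b + 1),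
    by positivity, fun i hi => (hpow _ _ (hrowne i hi) (mem_filter.1 hi).2.1).1,
    fun j hj => (hpow _ _ (hcolne j hj) (mem_filter.1 hj).2.1).1, ?_, ?_, ?_⟩
  · have h1 : (#(R' a b) : ℝ) * 8 ^ (a + 1) ≤ ∑ i ∈ R' a b, 8 * (rowDeg E C i : ℝ) := by
      rw [← nsmul_eq_mul, ← sum_const]
      exact sum_le_sum fun i hi => (hpow _ _ (hrowne i hi) (mem_filter.1 hi).2.1).2
    rw [← mul_sum] at h1 hab
    have h2 : (#(R' a b) : ℝ) * 8 ^ (a + 1) ≤ 38400 * L ^ 2 * edgeCount E (R' a b) (C' a b) := by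
      have h3 : θ * ((#(R' a b) : ℝ) * 8 ^ (a + 1)) ≤
          θ * (38400 * L ^ 2 * edgeCount E (R' a b) (C' a b)) := by
        rw [← mul_assoc θ (38400 * _), hθL]
        have := mul_le_mul_of_nonneg_left h1 hθ.le
        linarith
      exact le_of_mul_le_mul_left h3 hθ
    exact_mod_cast h2
  · have h1 : (#(C' a b) : ℝ) * 8 ^ (b + 1) ≤ ∑ j ∈ C' a b, 8 * (colDeg E R j : ℝ) := by
      rw [← nsmul_eq_mul, ← sum_const]
      exact sum_le_sum fun j hj => (hpow _ _ (hcolne j hj) (mem_filter.1 hj).2.1).2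
    rw [← mul_sum] at h1
    rw [← mul_sum (s := C' a b)] at hab
    have h2 : (#(C' a b) : ℝ) * 8 ^ (b + 1) ≤ 38400 * L ^ 2 * edgeCount E (R' a b) (C' a b) := by
      have h3 : θ * ((#(C' a b) : ℝ) * 8 ^ (b + 1)) ≤
          θ * (38400 * L ^ 2 * edgeCount E (R' a b) (C' a b)) := by
        rw [← mul_assoc θ (38400 * _), hθL]
        have := mul_le_mul_of_nonneg_left h1 hθ.le
        linarith
      exact le_of_mul_le_mul_left h3 hθ
    exact_mod_cast h2
  · have : (0 : ℝ) < edgeCount E (R' a b) (C' a b) := by linarith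
    exact_mod_cast this

end Blocks

/-! ### Density increment by random signs -/

section Boost

variable {ι κ : Type*}

/-- The signed sum `∑ ± x k`. -/
noncomputable def signSum {t : ℕ} (ε : Fin t → Bool) (x : Fin t → ℝ) : ℝ :=
  ∑ k, (if ε k then x k else -x k)

lemma sum_cons_bool {t : ℕ} (f : (Fin (t + 1) → Bool) → ℝ) :
    ∑ ε, f ε = ∑ ε : Fin t → Bool, (f (Fin.cons true ε) + f (Fin.cons false ε)) := by
  rw [← (Fin.consEquiv fun _ => Bool).sum_comp, Fintype.sum_prod_type, Fintype.sum_bool,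
    ← sum_add_distrib]
  rfl

lemma signSum_cons {t : ℕ} (b : Bool) (ε : Fin t → Bool) (x : Fin (t + 1) → ℝ) :
    signSum (Fin.cons b ε : Fin (t + 1) → Bool) x =
      (if b then x 0 else -x 0) + signSum ε (Fin.tail x) := by
  simp [signSum, Fin.sum_univ_succ, Fin.tail]

lemma sum_signSum_mul {t : ℕ} (x y : Fin t → ℝ) :
    ∑ ε, signSum ε x * signSum ε y = 2 ^ t * ∑ k, x k * y k := by
  induction t with
  | zero => simp [signSum]
  | succ t ih =>
    have h1 : (2 : ℝ) ^ t = ∑ ε : Fin t → Bool, 1 := by simp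
    have h2 : 2 ^ (t + 1) * ∑ k, x k * y k = 2 ^ t * (2 * (x 0 * y 0)) +
        2 * (2 ^ t * ∑ k, Fin.tail x k * Fin.tail y k) := by
      rw [Fin.sum_univ_succ, pow_succ]
      simp only [Fin.tail]
      ring
    rw [sum_cons_bool, h2, ← ih, h1, sum_mul, mul_sum, ← sum_add_distrib]
    simp only [signSum_cons]
    refine sum_congr rfl fun ε _ => ?_
    simp only [if_true, Bool.false_eq_true, if_false]
    ring

/-- The fourth-moment Khintchine inequality, obtained by splitting off one sign at a time. It bounds
the cost of truncation. -/
lemma sum_signSum_pow_four_le {t : ℕ} (x : Fin t → ℝ) :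
    ∑ ε, signSum ε x ^ 4 ≤ 2 ^ t * (3 * (∑ k, x k ^ 2) ^ 2) := by
  induction t with
  | zero => simp [signSum]
  | succ t ih =>
    have h2 := sum_signSum_mul (Fin.tail x) (Fin.tail x)
    have h1 : (2 : ℝ) ^ t = ∑ ε : Fin t → Bool, 1 := by simp
    have h3 : ∑ ε, signSum ε x ^ 4 = ∑ ε, (2 * signSum ε (Fin.tail x) ^ 4 +
        12 * x 0 ^ 2 * (signSum ε (Fin.tail x) * signSum ε (Fin.tail x)) + 2 * x 0 ^ 4 * 1) := by
      rw [sum_cons_bool]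
      refine sum_congr rfl fun ε _ => ?_
      simp only [signSum_cons, if_true, Bool.false_eq_true, if_false]
      ring
    rw [h3, sum_add_distrib, sum_add_distrib, ← mul_sum, ← mul_sum, ← mul_sum, h2, ← h1,
      Fin.sum_univ_succ]
    have h4 := ih (Fin.tail x)
    have h5 : ∑ k, Fin.tail x k * Fin.tail x k = ∑ k : Fin t, x k.succ ^ 2 :=
      sum_congr rfl fun k _ => by simp [Fin.tail, sq]
    have h6 : ∑ k, Fin.tail x k ^ 2 = ∑ k : Fin t, x k.succ ^ 2 := rfl
    rw [h6] at h4
    rw [h5]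
    have h7 : 0 ≤ (2 : ℝ) ^ t * x 0 ^ 4 := by positivity
    nlinarith [pow_succ (2 : ℝ) t]

/-- Truncation to `[-M, M]`. -/
noncomputable def clip (M x : ℝ) : ℝ := max (-M) (min x M)

lemma abs_clip_le {M : ℝ} (hM : 0 < M) (x : ℝ) : |clip M x| ≤ M :=
  abs_le.2 ⟨le_max_left _ _, max_le (by linarith) (min_le_right _ _)⟩

lemma clip_error {M : ℝ} (hM : 0 < M) (x : ℝ) :
    |clip M x| ≤ |x| ∧ |x - clip M x| * M ^ 2 ≤ |x| ^ 3 := by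
  rcases le_total x (-M) with h | h
  · have h1 : clip M x = -M := by rw [clip, min_eq_left (by linarith), max_eq_left h]
    rw [h1, abs_of_nonpos (by linarith : x ≤ 0), abs_of_nonpos (by linarith : x - -M ≤ 0),
      abs_of_neg (by linarith)]
    refine ⟨by linarith, ?_⟩
    have : M ^ 2 ≤ (-x) ^ 2 := pow_le_pow_left₀ hM.le (by linarith) 2
    nlinarith
  · rcases le_total x M with h' | h'
    · have h1 : clip M x = x := by rw [clip, min_eq_left h', max_eq_right h]
      rw [h1]; simp
    · have h1 : clip M x = M := by rw [clip, min_eq_right h', max_eq_right (by linarith)]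
      rw [h1, abs_of_nonneg (by linarith : 0 ≤ x), abs_of_nonneg (by linarith : 0 ≤ x - M),
        abs_of_pos hM]
      refine ⟨h', ?_⟩
      have : M ^ 2 ≤ x ^ 2 := pow_le_pow_left₀ hM.le h' 2
      nlinarith

lemma abs_mul_sub_clip_mul_clip_le {M : ℝ} (hM : 0 < M) (x y : ℝ) :
    |x * y - clip M x * clip M y| ≤ (x ^ 4 + y ^ 4) / M ^ 2 := by
  obtain ⟨hx, hx'⟩ := clip_error hM x
  obtain ⟨hy, hy'⟩ := clip_error hM y
  rw [le_div_iff₀ (by positivity)]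
  have h1 : |x * y - clip M x * clip M y| ≤ |x - clip M x| * |y| + |x| * |y - clip M y| := by
    have : x * y - clip M x * clip M y = (x - clip M x) * y + clip M x * (y - clip M y) := by ring
    rw [this]
    refine (abs_add_le _ _).trans ?_
    rw [abs_mul, abs_mul]
    gcongr
  have h2 : |x - clip M x| * |y| * M ^ 2 ≤ |x| ^ 3 * |y| := by
    nlinarith [abs_nonneg y]
  have h3 : |x| * |y - clip M y| * M ^ 2 ≤ |x| * |y| ^ 3 := by
    nlinarith [abs_nonneg x]
  have h4 : |x| ^ 3 * |y| + |x| * |y| ^ 3 ≤ x ^ 4 + y ^ 4 := by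
    have e : ∀ z : ℝ, z ^ 4 = |z| ^ 4 := fun z => ((even_two_mul 2).pow_abs z).symm
    rw [e x, e y]
    have : 0 ≤ (|x| - |y|) ^ 2 * (|x| ^ 2 + |x| * |y| + |y| ^ 2) := by positivity
    nlinarith
  have := mul_le_mul_of_nonneg_right h1 (sq_nonneg M)
  linarith

/-- Averaging over signs turns an inner product into products of bounded scalars. Truncating at `5 *
L` costs at most `2 * 3 * L ^ 2 / (5 * L) ^ 2 = 6 / 25` per sign pattern. -/
lemma abs_sum_clip_sub_le {t : ℕ} {L : ℝ} (hL : 0 < L) {x y : Fin t → ℝ}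
    (hx : ∑ k, x k ^ 2 ≤ L) (hy : ∑ k, y k ^ 2 ≤ L) :
    |2 ^ t * ∑ k, x k * y k - ∑ ε, clip (5 * L) (signSum ε x) * clip (5 * L) (signSum ε y)| ≤
      2 ^ t / 4 := by
  rw [← sum_signSum_mul, ← sum_sub_distrib]
  refine (abs_sum_le_sum_abs _ _).trans ((sum_le_sum fun ε _ =>
    abs_mul_sub_clip_mul_clip_le (by linarith : 0 < 5 * L) _ _).trans ?_)
  rw [← sum_div, sum_add_distrib, div_le_iff₀ (by positivity)]
  have key : ∀ z : Fin t → ℝ, ∑ k, z k ^ 2 ≤ L → ∑ ε, signSum ε z ^ 4 ≤ 2 ^ t * (3 * L ^ 2) :=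
    fun z hz => (sum_signSum_pow_four_le z).trans (by gcongr)
  have hp : 0 < (2 : ℝ) ^ t * L ^ 2 := by positivity
  nlinarith [key x hx, key y hy]

lemma exists_subset_sum_mul_le (S : Finset ι) (f h : ι → ℝ) (hf : ∀ i ∈ S, 0 ≤ f i ∧ f i ≤ 1) :
    ∃ S' ⊆ S, ∑ i ∈ S, f i * h i ≤ ∑ i ∈ S', h i := by
  refine ⟨{i ∈ S | 0 ≤ h i}, filter_subset _ _, ?_⟩
  rw [sum_filter]
  refine sum_le_sum fun i hi => ?_
  obtain ⟨h0, h1⟩ := hf i hi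
  split_ifs with h2 <;> nlinarith

/-- A form linear in each variable is maximized over `[0, 1]` weights at `0/1` weights, one variable
at a time. -/
lemma exists_subsets_bilinear_le (S : Finset ι) (T : Finset κ) (f : ι → ℝ) (g : κ → ℝ)
    (w : ι → κ → ℝ) (hf : ∀ i ∈ S, 0 ≤ f i ∧ f i ≤ 1) (hg : ∀ j ∈ T, 0 ≤ g j ∧ g j ≤ 1) :
    ∃ S' ⊆ S, ∃ T' ⊆ T, ∑ i ∈ S, ∑ j ∈ T, w i j * (f i * g j) ≤ ∑ i ∈ S', ∑ j ∈ T', w i j := by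
  obtain ⟨S', hS', h1⟩ := exists_subset_sum_mul_le S f (fun i => ∑ j ∈ T, w i j * g j) hf
  obtain ⟨T', hT', h2⟩ := exists_subset_sum_mul_le T g (fun j => ∑ i ∈ S', w i j) hg
  refine ⟨S', hS', T', hT', le_trans (le_of_eq ?_) (h1.trans ?_)⟩
  · refine sum_congr rfl fun i _ => ?_
    rw [mul_sum]
    exact sum_congr rfl fun j _ => by ring
  · rw [sum_comm, sum_comm (s := S')]
    refine le_trans (le_of_eq ?_) h2
    refine sum_congr rfl fun j _ => ?_
    rw [mul_sum]
    exact sum_congr rfl fun i _ => by ring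

lemma sum_sum_ite_eq_edgeCount (E : ι → κ → Prop) (S : Finset ι) (T : Finset κ) (μ : ℝ) :
    ∑ i ∈ S, ∑ j ∈ T, (if E i j then (1 : ℝ) else -μ) =
      edgeCount E S T - μ * edgeCount (fun i j => ¬ E i j) S T := by
  simp only [edgeCount, Nat.cast_sum, mul_sum, ← sum_sub_distrib, rowDeg]
  refine sum_congr rfl fun i _ => ?_
  rw [sum_ite]
  simp only [sum_const, nsmul_eq_mul]
  ring

/-- One step of density increment: passing to a subrectangle decreases the ratio of zeros to ones
by a factor `1 + 1 / (100 L ^ 2)`. -/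
lemma boost_step {t : ℕ} {L : ℝ} (hL : 1 ≤ L) {S : Finset ι} {T : Finset κ} {E : ι → κ → Prop}
    {u : ι → Fin t → ℝ} {v : κ → Fin t → ℝ}
    (huv : ∀ i ∈ S, ∀ j ∈ T, ∑ k, u i k * v j k = if E i j then 1 else 0)
    (hu : ∀ i ∈ S, ∑ k, u i k ^ 2 ≤ L) (hv : ∀ j ∈ T, ∑ k, v j k ^ 2 ≤ L) :
    ∃ S' ⊆ S, ∃ T' ⊆ T,
      (edgeCount E S T : ℝ) * (1 / (800 * L ^ 2)) ≤ edgeCount E S' T' ∧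
      (edgeCount (fun i j => ¬ E i j) S' T' : ℝ) * (1 + 1 / (100 * L ^ 2)) * edgeCount E S T ≤
        edgeCount (fun i j => ¬ E i j) S T * edgeCount E S' T' := by
  set a : ℝ := ((edgeCount E S T : ℕ) : ℝ) with ha
  set z : ℝ := ((edgeCount (fun i j => ¬ E i j) S T : ℕ) : ℝ) with hz
  set τ : ℝ := 1 / (100 * L ^ 2) with hτ
  have hτ0 : 0 < τ := by positivity
  have hτ1 : τ ≤ 1 / 2 := by
    rw [hτ, div_le_div_iff₀ (by positivity) (by norm_num)]; nlinarith
  have hτ8 : 1 / (800 * L ^ 2) = τ / 8 := by rw [hτ, div_div]; ring_nf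
  have ha0 : 0 ≤ a := by positivity
  have hz0 : 0 ≤ z := by positivity
  rw [hτ8]
  by_cases hz' : z = 0
  · refine ⟨S, Subset.rfl, T, Subset.rfl, ?_, ?_⟩
    · rw [← ha]; nlinarith
    · rw [← hz, hz']; simp
  by_cases ha' : a = 0
  · refine ⟨S, Subset.rfl, T, Subset.rfl, ?_, ?_⟩
    · rw [← ha, ha']; simp
    · rw [← ha, ha']; simp
  have hapos : 0 < a := lt_of_le_of_ne ha0 (Ne.symm ha')
  have hzpos : 0 < z := lt_of_le_of_ne hz0 (Ne.symm hz')
  -- The penalty on zeros exceeds the break-even value `a / z` by the factor `1 + τ`, so a rectangle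
  -- of nonnegative total weight has an improved ratio.
  set μ : ℝ := a / z * (1 + τ) with hμ
  have hμ0 : 0 < μ := by positivity
  have hμz : μ * z = a * (1 + τ) := by rw [hμ]; field_simp
  set w : ι → κ → ℝ := fun i j => if E i j then 1 else -μ with hw
  set M : ℝ := 5 * L with hM
  have hM0 : 0 < M := by positivity
  set f : (Fin t → Bool) → ι → ℝ := fun ε i => (1 + clip M (signSum ε (u i)) / M) / 2 with hf
  set g : (Fin t → Bool) → κ → ℝ := fun ε j => (1 + clip M (signSum ε (v j)) / M) / 2 with hg
  have h01 : ∀ x : ℝ, 0 ≤ (1 + clip M x / M) / 2 ∧ (1 + clip M x / M) / 2 ≤ 1 := by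
    intro x
    have h := abs_le.1 (abs_clip_le hM0 x)
    have h1 : -1 ≤ clip M x / M := by rw [le_div_iff₀ hM0]; linarith
    have h2 : clip M x / M ≤ 1 := by rw [div_le_iff₀ hM0]; linarith
    constructor <;> linarith
  -- the average over the signs
  have hpair : ∀ i ∈ S, ∀ j ∈ T, 2 ^ t * (w i j / 2 + (if E i j then 3 * τ / 2 else -μ * τ / 2)) ≤
      ∑ ε, w i j * (f ε i * g ε j + (1 - f ε i) * (1 - g ε j)) := by
    intro i hi j hj
    have h1 := abs_le.1 (abs_sum_clip_sub_le (by linarith : 0 < L) (hu i hi) (hv j hj))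
    rw [huv i hi j hj, ← hM] at h1
    set Q : ℝ := ∑ ε, clip M (signSum ε (u i)) * clip M (signSum ε (v j)) with hQ
    -- Here `f * g + (1 - f) * (1 - g)` equals `(1 + clip * clip / M ^ 2) / 2` and `1 / M ^ 2 = 4 *
    -- τ`. Its mean is at least `1 / 2 + 3 * τ / 2` on a one and at most `1 / 2 + τ / 2` on a zero.
    have h2 : ∑ ε, w i j * (f ε i * g ε j + (1 - f ε i) * (1 - g ε j)) =
        w i j / 2 * (2 ^ t + Q * (4 * τ)) := by
      have h3 : (2 : ℝ) ^ t = ∑ ε : Fin t → Bool, 1 := by simp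
      rw [h3, hQ, sum_mul, ← sum_add_distrib, mul_sum]
      refine sum_congr rfl fun ε _ => ?_
      have h4 : 4 * τ = 1 / M ^ 2 := by rw [hτ, hM]; field_simp; norm_num
      rw [h4, hf, hg]
      field_simp
      ring
    rw [h2]
    have hp : (0 : ℝ) < 2 ^ t := by positivity
    by_cases hE : E i j
    · simp only [hw, hE, if_true] at h1 ⊢
      nlinarith
    · simp only [hw, hE, if_false] at h1 ⊢
      have h5 : Q ≤ 2 ^ t / 4 := by linarith
      have h6 : 0 < μ * τ := by positivity
      nlinarith
  have hsum : 2 ^ t * (a * τ / 4) ≤ ∑ ε, ((∑ i ∈ S, ∑ j ∈ T, w i j * (f ε i * g ε j)) +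
      ∑ i ∈ S, ∑ j ∈ T, w i j * ((1 - f ε i) * (1 - g ε j))) := by
    have h1 := sum_le_sum fun i hi => sum_le_sum fun j hj => hpair i hi j hj
    have h2 : ∑ i ∈ S, ∑ j ∈ T, (2 : ℝ) ^ t * (w i j / 2 +
        (if E i j then 3 * τ / 2 else -μ * τ / 2)) =
        2 ^ t * ((a - μ * z) / 2 + τ / 2 * (3 * a - μ * z)) := by
      simp only [← mul_sum, sum_add_distrib, ← sum_div]
      congr 2
      · rw [ha, hz, ← sum_sum_ite_eq_edgeCount]
      · have h3 := sum_sum_ite_eq_edgeCount E S T (μ / 3)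
        have h4 : ∀ i j, (if E i j then 3 * τ / 2 else -μ * τ / 2) =
            3 * τ / 2 * (if E i j then (1 : ℝ) else -(μ / 3)) := by
          intro i j; split_ifs <;> ring
        simp only [h4, ← mul_sum]
        rw [h3, ← ha, ← hz]
        ring
    have h3 : ∑ i ∈ S, ∑ j ∈ T, ∑ ε, w i j * (f ε i * g ε j + (1 - f ε i) * (1 - g ε j)) =
        ∑ ε, ((∑ i ∈ S, ∑ j ∈ T, w i j * (f ε i * g ε j)) +
      ∑ i ∈ S, ∑ j ∈ T, w i j * ((1 - f ε i) * (1 - g ε j))) := by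
      simp only [← sum_add_distrib, ← mul_add]
      simp only [sum_comm (s := T)]
      rw [sum_comm]
    rw [h2, h3, hμz] at h1
    refine le_trans ?_ h1
    refine mul_le_mul_of_nonneg_left ?_ (by positivity)
    nlinarith [mul_pos hapos hτ0]
  obtain ⟨ε, hε⟩ : ∃ ε : Fin t → Bool, a * τ / 4 ≤
      (∑ i ∈ S, ∑ j ∈ T, w i j * (f ε i * g ε j)) +
      ∑ i ∈ S, ∑ j ∈ T, w i j * ((1 - f ε i) * (1 - g ε j)) := by
    by_contra hcon
    push Not at hcon
    have h1 := sum_lt_sum_of_nonempty (s := (univ : Finset (Fin t → Bool))) univ_nonempty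
      fun ε _ => hcon ε
    rw [sum_const, nsmul_eq_mul] at h1
    simp only [card_univ, Fintype.card_fun, Fintype.card_bool, Fintype.card_fin, Nat.cast_pow,
      Nat.cast_ofNat] at h1
    linarith
  -- One of the two complementary selections receives half of the weight. This single bound yields
  -- both conclusions: `a' ≥ a * τ / 8`, as zeros only subtract, and `μ * z' ≤ a'`.
  obtain ⟨S', hS', T', hT', h1⟩ : ∃ S' ⊆ S, ∃ T' ⊆ T,
      a * (τ / 8) ≤ ∑ i ∈ S', ∑ j ∈ T', w i j := by
    rcases le_total (a * τ / 8) (∑ i ∈ S, ∑ j ∈ T, w i j * (f ε i * g ε j)) with h | h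
    · obtain ⟨S', hS', T', hT', h1⟩ := exists_subsets_bilinear_le S T (f ε) (g ε) w
        (fun i _ => h01 _) (fun j _ => h01 _)
      exact ⟨S', hS', T', hT', by linarith⟩
    · obtain ⟨S', hS', T', hT', h1⟩ := exists_subsets_bilinear_le S T (fun i => 1 - f ε i)
        (fun j => 1 - g ε j) w
        (fun i _ => ⟨sub_nonneg.2 (h01 _).2, sub_le_self _ (h01 _).1⟩)
        (fun j _ => ⟨sub_nonneg.2 (h01 _).2, sub_le_self _ (h01 _).1⟩)
      exact ⟨S', hS', T', hT', by linarith⟩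
  rw [sum_sum_ite_eq_edgeCount] at h1
  set a' : ℝ := ((edgeCount E S' T' : ℕ) : ℝ)
  set z' : ℝ := ((edgeCount (fun i j => ¬ E i j) S' T' : ℕ) : ℝ)
  have hz1 : 0 ≤ z' := Nat.cast_nonneg _
  refine ⟨S', hS', T', hT', by nlinarith, ?_⟩
  have h2 : μ * z' ≤ a' := by nlinarith
  have h3 : z * (μ * z') ≤ z * a' := mul_le_mul_of_nonneg_left h2 hz0
  calc z' * (1 + τ) * a = z * (μ * z') := by rw [← mul_assoc, mul_comm z μ, hμz]; ring
    _ ≤ _ := h3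

lemma boost_iterate {t : ℕ} {L : ℝ} (hL : 1 ≤ L) {S : Finset ι} {T : Finset κ}
    {E : ι → κ → Prop} {u : ι → Fin t → ℝ} {v : κ → Fin t → ℝ}
    (huv : ∀ i ∈ S, ∀ j ∈ T, ∑ k, u i k * v j k = if E i j then 1 else 0)
    (hu : ∀ i ∈ S, ∑ k, u i k ^ 2 ≤ L) (hv : ∀ j ∈ T, ∑ k, v j k ^ 2 ≤ L)
    (he : 0 < edgeCount E S T) (n : ℕ) :
    ∃ S' ⊆ S, ∃ T' ⊆ T,
      (edgeCount E S T : ℝ) * (1 / (800 * L ^ 2)) ^ n ≤ edgeCount E S' T' ∧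
      (edgeCount (fun i j => ¬ E i j) S' T' : ℝ) * (1 + 1 / (100 * L ^ 2)) ^ n *
        edgeCount E S T ≤ edgeCount (fun i j => ¬ E i j) S T * edgeCount E S' T' := by
  induction n with
  | zero => exact ⟨S, Subset.rfl, T, Subset.rfl, by simp, by simp⟩
  | succ n ih =>
    obtain ⟨S', hS', T', hT', h1, h2⟩ := ih
    obtain ⟨S'', hS'', T'', hT'', h3, h4⟩ := boost_step hL
      (fun i hi j hj => huv i (hS' hi) j (hT' hj)) (fun i hi => hu i (hS' hi))
      (fun j hj => hv j (hT' hj))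
    have ha : (0 : ℝ) < edgeCount E S T := by exact_mod_cast he
    have ha' : (0 : ℝ) < edgeCount E S' T' := lt_of_lt_of_le (by positivity) h1
    refine ⟨S'', hS''.trans hS', T'', hT''.trans hT', ?_, ?_⟩
    · rw [pow_succ, ← mul_assoc]
      exact le_trans (mul_le_mul_of_nonneg_right h1 (by positivity)) h3
    · refine le_of_mul_le_mul_right ?_ ha'
      calc _ = (edgeCount (fun i j => ¬ E i j) S'' T'' : ℝ) * (1 + 1 / (100 * L ^ 2)) *
            edgeCount E S' T' * ((1 + 1 / (100 * L ^ 2)) ^ n * edgeCount E S T) := by ring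
        _ ≤ edgeCount (fun i j => ¬ E i j) S' T' * edgeCount E S'' T'' *
            ((1 + 1 / (100 * L ^ 2)) ^ n * edgeCount E S T) :=
          mul_le_mul_of_nonneg_right h4 (by positivity)
        _ = edgeCount (fun i j => ¬ E i j) S' T' * (1 + 1 / (100 * L ^ 2)) ^ n *
            edgeCount E S T * edgeCount E S'' T'' := by ring
        _ ≤ edgeCount (fun i j => ¬ E i j) S T * edgeCount E S' T' * edgeCount E S'' T'' :=
          mul_le_mul_of_nonneg_right h2 (by positivity)
        _ = _ := by ring

end Boost

/-! ### Zero rectangles in very sparse matrices -/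

section Sparse

variable {ι κ H : Type*} [NormedAddCommGroup H] [InnerProductSpace ℝ H]

/-- A sum of `k` vectors of a centred family can be chosen to grow like `√k`. -/
lemma exists_norm_sum_sq_le {τ : Finset κ} (hτ : τ.Nonempty) {y : κ → H} (hy : ∑ j ∈ τ, y j = 0)
    {B : ℝ} (hB : ∑ j ∈ τ, ‖y j‖ ^ 2 ≤ #τ * B) (k : ℕ) :
    ∃ J : Fin k → κ, (∀ r, J r ∈ τ) ∧ ‖∑ r, y (J r)‖ ^ 2 ≤ k * B := by
  induction k with
  | zero => exact ⟨Fin.elim0, fun r => r.elim0, by simp⟩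
  | succ k ih =>
    obtain ⟨J, hJ, h1⟩ := ih
    set s := ∑ r, y (J r) with hs
    obtain ⟨j, hj, h2⟩ : ∃ j ∈ τ, ‖y j + s‖ ^ 2 ≤ B + ‖s‖ ^ 2 := by
      refine exists_le_of_sum_le hτ ?_
      have h3 : ∑ j ∈ τ, ‖y j + s‖ ^ 2 =
          ∑ j ∈ τ, ‖y j‖ ^ 2 + 2 * inner ℝ (∑ j ∈ τ, y j) s + ∑ j ∈ τ, ‖s‖ ^ 2 := by
        simp only [norm_add_sq_real, sum_add_distrib, sum_inner, mul_sum]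
      rw [h3, hy, inner_zero_left, sum_add_distrib, sum_const, sum_const, nsmul_eq_mul,
        nsmul_eq_mul]
      linarith
    refine ⟨Fin.cons j J, fun r => ?_, ?_⟩
    · refine Fin.cases ?_ (fun r => ?_) r
      · exact hj
      · exact hJ r
    · simp only [Fin.sum_univ_succ, Fin.cons_zero, Fin.cons_succ]
      push_cast
      linarith

/-- If a family of short vectors lies on an affine hyperplane away from the origin, subtracting a
suitable average of few of its members shortens many of its members. -/
lemma exists_average_shortening {τ : Finset κ} (hτ : τ.Nonempty) {v : κ → H} {x : H}
    (hx : ‖x‖ ^ 2 ≤ 1) (hxv : ∀ j ∈ τ, inner ℝ x (v j) = 1) {B : ℝ}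
    (hB : ∀ j ∈ τ, ‖v j‖ ^ 2 ≤ B) {k : ℕ} (hk : 4 * B ≤ k) :
    ∃ J : Fin k → κ, (∀ r, J r ∈ τ) ∧
      (#τ : ℝ) ≤ 2 * B * #{j ∈ τ | ‖v j - (1 / k : ℝ) • ∑ r, v (J r)‖ ^ 2 ≤ B - 1 / 4} := by
  have hN : (0 : ℝ) < #τ := by exact_mod_cast hτ.card_pos
  set m : H := (1 / #τ : ℝ) • ∑ j ∈ τ, v j with hm
  have hxm : inner ℝ x m = (1 : ℝ) := by
    rw [hm, inner_smul_right, inner_sum, sum_congr rfl hxv, sum_const, nsmul_eq_mul]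
    field_simp
  -- The hyperplane is at distance at least `1` from the origin, so the mean is long and the
  -- variance is at most `B - 1`.
  have hm1 : 1 ≤ ‖m‖ ^ 2 := by
    have h1 := real_inner_le_norm x m
    rw [hxm] at h1
    have h2 : 1 ≤ (‖x‖ * ‖m‖) ^ 2 := by nlinarith
    rw [mul_pow] at h2
    nlinarith [sq_nonneg ‖m‖]
  have hcent : ∑ j ∈ τ, (v j - m) = 0 := by
    rw [sum_sub_distrib, sum_const, hm, ← Nat.cast_smul_eq_nsmul ℝ, smul_smul,
      mul_one_div_cancel hN.ne', one_smul, sub_self]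
  have hvar : ∑ j ∈ τ, ‖v j - m‖ ^ 2 ≤ #τ * (B - 1) := by
    have h1 : ∑ j ∈ τ, ‖v j‖ ^ 2 = ∑ j ∈ τ, ‖v j - m‖ ^ 2 + 2 * inner ℝ (∑ j ∈ τ, (v j - m)) m +
        ∑ j ∈ τ, ‖m‖ ^ 2 := by
      rw [sum_inner, mul_sum, ← sum_add_distrib, ← sum_add_distrib]
      refine sum_congr rfl fun j _ => ?_
      rw [← norm_add_sq_real, sub_add_cancel]
    rw [hcent, inner_zero_left, sum_const, nsmul_eq_mul] at h1
    have h2 := sum_le_sum hB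
    rw [sum_const, nsmul_eq_mul] at h2
    nlinarith
  have hB1 : 1 ≤ B := by
    have : 0 ≤ (#τ : ℝ) * (B - 1) := (sum_nonneg fun _ _ => by positivity).trans hvar
    nlinarith
  have hk0 : (0 : ℝ) < k := by linarith
  obtain ⟨J, hJ, h1⟩ := exists_norm_sum_sq_le hτ hcent hvar k
  refine ⟨J, hJ, ?_⟩
  set w : H := (1 / k : ℝ) • ∑ r, v (J r) with hw
  have hwm : ‖m - w‖ ^ 2 ≤ 1 / 4 := by
    have h2 : m - w = -((1 / k : ℝ) • ∑ r, (v (J r) - m)) := by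
      rw [sum_sub_distrib, smul_sub, ← hw, sum_const, card_univ, Fintype.card_fin,
        ← Nat.cast_smul_eq_nsmul ℝ, smul_smul, one_div_mul_cancel hk0.ne', one_smul]
      abel
    rw [h2, norm_neg, norm_smul, mul_pow, Real.norm_of_nonneg (by positivity), div_pow, one_pow]
    rw [div_mul_eq_mul_div, one_mul, div_le_iff₀ (by positivity)]
    nlinarith
  -- The sampled average is within `1 / 2` of the mean, so the mean squared distance to it is at
  -- most `B - 1 + 1 / 4`. Markov's inequality at level `B - 1 / 4` leaves a `1 / (2 * B)` fraction
  -- of good columns.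
  have htot : ∑ j ∈ τ, ‖v j - w‖ ^ 2 ≤ #τ * (B - 3 / 4) := by
    have h2 : ∑ j ∈ τ, ‖v j - w‖ ^ 2 = ∑ j ∈ τ, ‖v j - m‖ ^ 2 +
        2 * inner ℝ (∑ j ∈ τ, (v j - m)) (m - w) + ∑ j ∈ τ, ‖m - w‖ ^ 2 := by
      rw [sum_inner, mul_sum, ← sum_add_distrib, ← sum_add_distrib]
      refine sum_congr rfl fun j _ => ?_
      rw [← norm_add_sq_real, sub_add_sub_cancel]
    rw [hcent, inner_zero_left, sum_const, nsmul_eq_mul] at h2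
    nlinarith
  have hbad : (#{j ∈ τ | ¬ ‖v j - w‖ ^ 2 ≤ B - 1 / 4} : ℝ) * (B - 1 / 4) ≤
      ∑ j ∈ τ, ‖v j - w‖ ^ 2 := by
    rw [← nsmul_eq_mul, ← sum_const]
    refine (sum_le_sum fun j hj => (not_le.1 (mem_filter.1 hj).2).le).trans ?_
    exact sum_le_sum_of_subset_of_nonneg (filter_subset _ _) fun _ _ _ => by positivity
  have hcard : (#{j ∈ τ | ‖v j - w‖ ^ 2 ≤ B - 1 / 4} : ℝ) +
      #{j ∈ τ | ¬ ‖v j - w‖ ^ 2 ≤ B - 1 / 4} = #τ := by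
    exact_mod_cast card_filter_add_card_filter_not (s := τ)
      fun j => ‖v j - w‖ ^ (2 : ℕ) ≤ B - 1 / 4
  have : (0 : ℝ) ≤ #{j ∈ τ | ‖v j - w‖ ^ 2 ≤ B - 1 / 4} := by positivity
  nlinarith

/-- Unless `U` is much smaller than `C`, there is a row adjacent to many columns of `U` of
comparable degrees. -/
lemma exists_cluster {S : Finset ι} {C U : Finset κ} {Z : ι → κ → Prop} {u : ι → H} {v : κ → H}
    {Λ : ℝ} (hΛ : 0 < Λ)
    (huv : ∀ i ∈ S, ∀ j ∈ C, inner ℝ (u i) (v j) = if Z i j then 1 else 0)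
    (hu : ∀ i ∈ S, ‖u i‖ ^ 2 ≤ 1) (hv : ∀ j ∈ C, ‖v j‖ ^ 2 ≤ Λ) (hUC : U ⊆ C)
    (hd : ∀ j ∈ C, 0 < colDeg Z S j) (hU : (7 / 10 : ℝ) * #C < #U) :
    ∃ τ ⊆ U, τ.Nonempty ∧ (∃ i ∈ S, ∀ j ∈ τ, Z i j) ∧
      ∀ j ∈ τ, (colDeg Z S j : ℝ) * #C ≤ 256000 * Λ * #S * #τ := by
  set d : κ → ℝ := fun j => colDeg Z S j with hddef
  have hd' : ∀ j ∈ C, 0 < d j := fun j hj => Nat.cast_pos.2 (hd j hj)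
  -- With weight `1 / d j` the edges at each column weigh `1` in total, so a set of columns weighs
  -- its cardinality whatever the degrees.
  have hω : ∀ j ∈ C, 0 < 1 / d j := fun j hj => one_div_pos.2 (hd' j hj)
  set θ : ℝ := 1 / (1600 * Λ) with hθ
  have hθ0 : 0 < θ := by positivity
  obtain ⟨j₀, hj₀⟩ : U.Nonempty := by
    rw [← card_pos]
    have : (0 : ℝ) < #U := lt_of_le_of_lt (by positivity) hU
    exact_mod_cast this
  have hSpos : (0 : ℝ) < #S := by
    have h1 := hd j₀ (hUC hj₀)
    have h2 : colDeg Z S j₀ ≤ #S := card_filter_le _ _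
    exact_mod_cast h1.trans_le h2
  have hCpos : (0 : ℝ) < #C := by
    exact_mod_cast card_pos.2 ⟨j₀, hUC hj₀⟩
  have hsp := spread_weight_le (ω := fun j => 1 / d j) hθ0 hω huv hu hv
    (le_of_eq (by rw [hθ]; field_simp))
  have hCsum : ∑ j ∈ C, 1 / d j * colDeg Z S j = #C := by
    rw [card_eq_sum_ones]; push_cast
    exact sum_congr rfl fun j hj => one_div_mul_cancel (hd' j hj).ne'
  rw [hCsum] at hsp
  set g : ℝ := θ * (#C / (10 * #S)) with hg
  set D : ι → ℝ := fun i => ∑ j ∈ C with Z i j, 1 / d j with hD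
  have hnn : ∀ (P : κ → Prop), ∀ X ⊆ C, 0 ≤ ∑ j ∈ X with P j, 1 / d j :=
    fun P X hX => sum_nonneg fun j hj => (hω j (hX (mem_filter.1 hj).1)).le
  have hdouble : ∀ X ⊆ C, ∑ i ∈ S, ∑ j ∈ X with Z i j, 1 / d j = #X := by
    intro X hX
    rw [sum_filter_swap, card_eq_sum_ones]; push_cast
    refine sum_congr rfl fun j hj => ?_
    rw [sum_const, nsmul_eq_mul]
    exact mul_one_div_cancel (hd' j (hX hj)).ne'
  obtain ⟨i, hi, b, hib⟩ : ∃ i ∈ S, ∃ b : ℕ,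
      g / 2 ≤ ∑ j ∈ U with Z i j ∧ Nat.log 8 (colDeg Z S j) = b, 1 / d j := by
    by_contra hcon
    push Not at hcon
    -- Summed over rows, the three terms give at most `#C / 10`, `#C / 2` and `#C / 10`, hence the
    -- threshold `7 / 10`.
    have hrow : ∀ i ∈ S, ∑ j ∈ U with Z i j, 1 / d j ≤
        ∑ j ∈ C with Spread Z S C (fun j => 1 / d j) θ i j, 1 / d j +
          (D i / 2 + #C / (10 * #S)) := by
      intro i hi
      rw [← sum_filter_add_sum_filter_not (U.filter (Z i ·))
        (fun j => Spread Z S C (fun j => 1 / d j) θ i j)]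
      have hDi : 0 ≤ D i := hnn _ C Subset.rfl
      refine add_le_add ?_ ?_
      · refine sum_le_sum_of_subset_of_nonneg (fun j hj => ?_) fun j hj _ =>
          (hω j (mem_filter.1 hj).1).le
        simp only [mem_filter] at hj ⊢
        exact ⟨hUC hj.1.1, hj.2⟩
      · by_cases hsmall : D i ≤ #C / (10 * #S)
        · have : ∑ j ∈ (U.filter (Z i ·)) with ¬ Spread Z S C (fun j => 1 / d j) θ i j, 1 / d j ≤
              D i := by
            refine sum_le_sum_of_subset_of_nonneg (fun j hj => ?_) fun j hj _ =>
              (hω j (mem_filter.1 hj).1).le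
            simp only [mem_filter] at hj ⊢
            exact ⟨hUC hj.1.1, hj.1.2⟩
          linarith
        · push Not at hsmall
          suffices h : ∑ j ∈ (U.filter (Z i ·)) with
              ¬ Spread Z S C (fun j => 1 / d j) θ i j, 1 / d j ≤ D i / 2 by
            have : (0 : ℝ) < #C / (10 * #S) := by positivity
            linarith
          set cl : κ → ℕ := fun j => Nat.log 8 (colDeg Z S j) with hcl
          rw [← sum_fiberwise_of_maps_to (t := C.image cl) (g := cl)
            (fun j hj => mem_image_of_mem cl (hUC (mem_filter.1 (mem_filter.1 hj).1).1)), hD]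
          simp only
          rw [← sum_fiberwise_of_maps_to (s := C.filter (Z i ·)) (t := C.image cl) (g := cl)
            (fun j hj => mem_image_of_mem cl (mem_filter.1 hj).1), sum_div]
          refine sum_le_sum fun b _ => ?_
          have hcls : 0 ≤ ∑ j ∈ C.filter (Z i ·) with cl j = b, 1 / d j :=
            sum_nonneg fun j hj => (hω j (mem_filter.1 (mem_filter.1 hj).1).1).le
          rcases (((U.filter (Z i ·)).filter
            (fun j => ¬ Spread Z S C (fun j => 1 / d j) θ i j)).filter
              (fun j => cl j = b)).eq_empty_or_nonempty with hemp | ⟨j₁, hj₁⟩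
          · rw [hemp, sum_empty]; linarith
          · have h1 := hcon i hi b
            have h2 : ∑ j ∈ ((U.filter (Z i ·)).filter
                (fun j => ¬ Spread Z S C (fun j => 1 / d j) θ i j)) with cl j = b, 1 / d j ≤
                ∑ j ∈ U with Z i j ∧ Nat.log 8 (colDeg Z S j) = b, 1 / d j := by
              refine sum_le_sum_of_subset_of_nonneg (fun j hj => ?_) fun j hj _ =>
                (hω j (hUC (mem_filter.1 hj).1)).le
              simp only [mem_filter] at hj ⊢
              exact ⟨hj.1.1.1, hj.1.1.2, hj.2⟩
            -- A class containing a non-spread edge weighs more than `θ * D i ≥ g` in `C`, but less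
            -- than `g / 2` in `U` by assumption; so `U` holds at most half of it.
            have h3 : θ * D i < ∑ j ∈ C.filter (Z i ·) with cl j = b, 1 / d j := by
              simp only [mem_filter] at hj₁
              by_contra h
              refine hj₁.1.2 ⟨hj₁.1.1.2, ?_⟩
              rw [filter_filter, ← hj₁.2] at h
              exact not_lt.1 h
            have h4 : g ≤ θ * D i := mul_le_mul_of_nonneg_left hsmall.le hθ0.le
            linarith
    have h1 := sum_le_sum hrow
    rw [hdouble U hUC, sum_add_distrib, sum_add_distrib, ← sum_div, hdouble C Subset.rfl,
      sum_const, nsmul_eq_mul] at h1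
    have h2 : (#S : ℝ) * (#C / (10 * #S)) = #C / 10 := by field_simp
    linarith
  refine ⟨{j ∈ U | Z i j ∧ Nat.log 8 (colDeg Z S j) = b}, filter_subset _ _, ?_,
    ⟨i, hi, fun j hj => (mem_filter.1 hj).2.1⟩, ?_⟩
  · rw [nonempty_iff_ne_empty]
    intro h
    rw [h, sum_empty] at hib
    have : 0 < g := by positivity
    linarith
  · intro j hj
    set τ := {j ∈ U | Z i j ∧ Nat.log 8 (colDeg Z S j) = b} with hτ
    have hjC : j ∈ C := hUC (mem_filter.1 hj).1
    have h1 : ∀ j' ∈ τ, d j / d j' ≤ 8 := by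
      intro j' hj'
      have hj'C : j' ∈ C := hUC (mem_filter.1 hj').1
      rw [div_le_iff₀ (hd' j' hj'C)]
      have h2 : colDeg Z S j < 8 ^ (b + 1) := by
        rw [← (mem_filter.1 hj).2.2]
        exact Nat.lt_pow_succ_log_self (by norm_num) _
      have h3 : 8 ^ b ≤ colDeg Z S j' := by
        rw [← (mem_filter.1 hj').2.2]
        exact Nat.pow_log_le_self 8 (hd j' hj'C).ne'
      have h4 : colDeg Z S j ≤ 8 * colDeg Z S j' := by rw [pow_succ] at h2; omega
      change (colDeg Z S j : ℝ) ≤ 8 * colDeg Z S j'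
      exact_mod_cast h4
    have h2 : d j * (g / 2) ≤ 8 * #τ := by
      refine (mul_le_mul_of_nonneg_left hib (hd' j hjC).le).trans ?_
      rw [mul_sum, mul_comm, ← nsmul_eq_mul, ← sum_const]
      refine sum_le_sum fun j' hj' => ?_
      rw [mul_one_div]
      exact h1 j' hj'
    have h3 : d j * #C = d j * (g / 2) * (32000 * Λ * #S) := by
      rw [hg, hθ]; field_simp; ring
    have h4 : (d j) * #C ≤ 8 * #τ * (32000 * Λ * #S) := by
      rw [h3]; exact mul_le_mul_of_nonneg_right h2 (by positivity)
    refine h4.trans (le_of_eq (by ring))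

/-- Subtracting `w j` from `v j` shortens the vectors of the columns `G` and does not change their
inner products with the vectors of the rows outside `D`. -/
def IsShift (u : ι → H) (v : κ → H) (B : ℝ) (S D : Finset ι) (G : Finset κ) (w : κ → H) : Prop :=
  ∀ j ∈ G, ‖v j - w j‖ ^ 2 ≤ B - 1 / 4 ∧ ∀ i ∈ S, i ∉ D → inner ℝ (u i) (w j) = (0 : ℝ)

/-- The common neighbour puts the vectors of `τ` on a hyperplane, so `exists_average_shortening`
applies. The shift averages `4 * Λ` of them, and `D` is the set of neighbours of the sampled
columns, small because their degrees are. -/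
lemma exists_cluster_shift {S : Finset ι} {C τ : Finset κ} {Z : ι → κ → Prop} {u : ι → H}
    {v : κ → H} {Λ : ℕ} {B : ℝ} (hB : B ≤ Λ)
    (huv : ∀ i ∈ S, ∀ j ∈ C, inner ℝ (u i) (v j) = if Z i j then 1 else 0)
    (hu : ∀ i ∈ S, ‖u i‖ ^ 2 ≤ 1) (hv : ∀ j ∈ C, ‖v j‖ ^ 2 ≤ B) (hτC : τ ⊆ C) (hτ : τ.Nonempty)
    (hi : ∃ i ∈ S, ∀ j ∈ τ, Z i j)
    (hdeg : ∀ j ∈ τ, (colDeg Z S j : ℝ) * #C ≤ 256000 * Λ * #S * #τ)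
    (hsmall : ∀ j ∈ C, 128 * Λ * colDeg Z S j ≤ #S) :
    ∃ D ⊆ S, ∃ G ⊆ τ, ∃ w : κ → H, #D * #C ≤ 1024000 * Λ ^ 2 * #S * #τ ∧ 2 * #D ≤ #S ∧
      #τ ≤ 2 * Λ * #G ∧ IsShift u v B S D G w := by
  obtain ⟨i, hi, hiτ⟩ := hi
  obtain ⟨J, hJ, h1⟩ := exists_average_shortening hτ (hu i hi)
    (fun j hj => by rw [huv i hi j (hτC hj), if_pos (hiτ j hj)]) (fun j hj => hv j (hτC hj))
    (k := 4 * Λ) (by push_cast; linarith)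
  have hD : #{i ∈ S | ∃ r, Z i (J r)} ≤ ∑ r, colDeg Z S (J r) := by
    refine le_trans (card_le_card fun i hi => ?_) card_biUnion_le
    obtain ⟨hiS, r, hr⟩ := mem_filter.1 hi
    exact mem_biUnion.2 ⟨r, mem_univ _, mem_filter.2 ⟨hiS, hr⟩⟩
  refine ⟨{i ∈ S | ∃ r, Z i (J r)}, filter_subset _ _, _, filter_subset _ _,
    fun _ => (1 / (4 * Λ : ℕ) : ℝ) • ∑ r, v (J r), ?_, ?_, ?_, fun j hj => ⟨(mem_filter.1 hj).2,
      fun i hi hiD => ?_⟩⟩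
  · have h2 : (∑ r, colDeg Z S (J r)) * #C ≤ 4 * Λ * (256000 * Λ * #S * #τ) := by
      rw [sum_mul]
      refine (sum_le_card_nsmul univ _ _ fun r _ => ?_).trans
        (le_of_eq (by rw [card_univ, Fintype.card_fin, smul_eq_mul]))
      exact_mod_cast hdeg (J r) (hJ r)
    refine (Nat.mul_le_mul_right _ hD).trans (h2.trans (le_of_eq (by ring)))
  · have h2 : 32 * ∑ r, colDeg Z S (J r) ≤ #S := by
      rcases Nat.eq_zero_or_pos Λ with rfl | hΛ
      · simp
      · have h3 : ∀ r, Λ * (128 * colDeg Z S (J r)) ≤ #S := fun r =>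
          le_trans (le_of_eq (by ring)) (hsmall _ (hτC (hJ r)))
        have h4 := sum_le_sum fun (r : Fin (4 * Λ)) (_ : r ∈ univ) => h3 r
        rw [← mul_sum, ← mul_sum, sum_const, card_univ, Fintype.card_fin, smul_eq_mul] at h4
        refine le_of_mul_le_mul_left ?_ (by omega : 0 < 4 * Λ)
        refine le_trans (le_of_eq (by ring)) h4
    omega
  · have h2 : (#τ : ℝ) ≤ 2 * Λ * #{j ∈ τ | ‖v j - (1 / (4 * Λ : ℕ) : ℝ) • ∑ r, v (J r)‖ ^ (2 : ℕ) ≤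
        B - 1 / 4} := h1.trans (by gcongr)
    exact_mod_cast h2
  · rw [inner_smul_right, inner_sum]
    refine mul_eq_zero_of_right _ (sum_eq_zero fun r _ => ?_)
    rw [huv i hi _ (hτC (hJ r)), if_neg]
    exact fun h => hiD (mem_filter.2 ⟨hi, r, h⟩)

/-- A single cluster may be tiny, so disjoint clusters are accumulated. Each spoils rows in
proportion to its number of columns, so a fixed proportion of the columns can be collected while
spoiling at most half of the rows. -/
lemma sparse_step {S : Finset ι} {T : Finset κ} {Z : ι → κ → Prop} {u : ι → H} {v : κ → H}
    {Λ : ℕ} (hΛ : 0 < Λ) {B : ℝ} (hB : B ≤ Λ)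
    (huv : ∀ i ∈ S, ∀ j ∈ T, inner ℝ (u i) (v j) = if Z i j then 1 else 0)
    (hu : ∀ i ∈ S, ‖u i‖ ^ 2 ≤ 1) (hv : ∀ j ∈ T, ‖v j‖ ^ 2 ≤ B) (hS : S.Nonempty)
    (hT : T.Nonempty) (he : edgeCount Z S T * (512 * Λ) ≤ #S * #T) :
    (∃ T' ⊆ T, edgeCount Z S T' = 0 ∧ #T ≤ 4 * #T') ∨
    ∃ S' ⊆ S, ∃ T' ⊆ T, ∃ w : κ → H, (∀ i ∈ S', ∀ j ∈ T', inner ℝ (u i) (w j) = (0 : ℝ)) ∧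
      (∀ j ∈ T', ‖v j - w j‖ ^ 2 ≤ B - 1 / 4) ∧ #S * #T ≤ 10 ^ 8 * Λ ^ 3 * (#S' * #T') := by
  by_cases hzero : #T ≤ 4 * #{j ∈ T | colDeg Z S j = 0}
  · refine Or.inl ⟨_, filter_subset _ _, ?_, hzero⟩
    rw [edgeCount_eq_sum_colDeg]
    exact sum_eq_zero fun j hj => (mem_filter.1 hj).2
  refine Or.inr ?_
  push Not at hzero
  set e := edgeCount Z S T with hedef
  have hesum : e = ∑ j ∈ T, colDeg Z S j := edgeCount_eq_sum_colDeg Z S T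
  have hepos : 0 < e := by
    rw [Nat.pos_iff_ne_zero]
    intro h0
    rw [hesum, sum_eq_zero_iff] at h0
    rw [filter_true_of_mem h0] at hzero
    omega
  -- Fewer than a quarter of the columns are empty, and at most a quarter exceed four times the mean
  -- degree; `C` keeps the other half.
  set C : Finset κ := {j ∈ T | 0 < colDeg Z S j ∧ colDeg Z S j * #T ≤ 4 * e} with hC
  have hCT : C ⊆ T := filter_subset _ _
  have hTC : #T ≤ 2 * #C := by
    have h1 : #{j ∈ T | 4 * e < colDeg Z S j * #T} * (4 * e) ≤ e * #T := by
      rw [← smul_eq_mul, ← sum_const]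
      refine (sum_le_sum fun j hj => (mem_filter.1 hj).2.le).trans ?_
      rw [hesum, sum_mul]
      exact sum_le_sum_of_subset (filter_subset _ _)
    have h2 : 4 * #{j ∈ T | 4 * e < colDeg Z S j * #T} ≤ #T :=
      le_of_mul_le_mul_left (le_trans (le_of_eq (by ring)) h1) hepos
    have h3 : #T ≤ #{j ∈ T | colDeg Z S j = 0} + #{j ∈ T | 4 * e < colDeg Z S j * #T} + #C := by
      refine le_trans (card_le_card fun j hj => ?_)
        ((card_union_le _ _).trans (Nat.add_le_add_right (card_union_le _ _) _))
      simp only [hC, mem_union, mem_filter, hj, true_and]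
      omega
    omega
  have hSpos : 0 < #S := hS.card_pos
  have hTpos : 0 < #T := hT.card_pos
  have hCpos : 0 < #C := by omega
  have hsmall : ∀ j ∈ C, 128 * Λ * colDeg Z S j ≤ #S := by
    intro j hj
    have h1 := (mem_filter.1 hj).2.2
    refine le_of_mul_le_mul_right ?_ (by omega : 0 < 4 * #T)
    calc 128 * Λ * colDeg Z S j * (4 * #T) = 512 * Λ * (colDeg Z S j * #T) := by ring
      _ ≤ 512 * Λ * (4 * e) := Nat.mul_le_mul_left _ h1
      _ = 4 * (e * (512 * Λ)) := by ring
      _ ≤ 4 * (#S * #T) := Nat.mul_le_mul_left _ he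
      _ = _ := by ring
  have huvC : ∀ i ∈ S, ∀ j ∈ C, inner ℝ (u i) (v j) = if Z i j then (1 : ℝ) else 0 :=
    fun i hi j hj => huv i hi j (hCT hj)
  have hvC : ∀ j ∈ C, ‖v j‖ ^ 2 ≤ B := fun j hj => hv j (hCT hj)
  set Q := 1024000 * Λ ^ 2 with hQ
  have hQpos : 0 < Q := by positivity
  suffices h : ∃ D ⊆ S, ∃ G ⊆ C, ∃ w : κ → H, 2 * #D ≤ #S ∧ #C ≤ 4 * Q * (2 * Λ * #G) ∧
      IsShift u v B S D G w by
    obtain ⟨D, hD, G, hG, w, h1, h2, h3⟩ := h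
    refine ⟨S \ D, sdiff_subset, G, hG.trans hCT, w, fun i hi j hj => ?_,
      fun j hj => (h3 j hj).1, ?_⟩
    · rw [mem_sdiff] at hi
      exact (h3 j hj).2 i hi.1 hi.2
    · have h4 : #S ≤ 2 * #(S \ D) := by
        rw [card_sdiff_of_subset hD]; omega
      calc #S * #T ≤ (2 * #(S \ D)) * (2 * (4 * Q * (2 * Λ * #G))) :=
            Nat.mul_le_mul h4 (hTC.trans (Nat.mul_le_mul_left _ h2))
        _ = 32768000 * (Λ ^ 3 * (#(S \ D) * #G)) := by rw [hQ]; ring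
        _ ≤ 10 ^ 8 * (Λ ^ 3 * (#(S \ D) * #G)) := Nat.mul_le_mul_right _ (by norm_num)
        _ = _ := by ring
  set Good : Finset κ → Prop := fun X => 2 * Q * #X ≤ #C ∧ ∃ D ⊆ S, ∃ G ⊆ X, ∃ w : κ → H,
    #D * #C ≤ Q * #S * #X ∧ #X ≤ 2 * Λ * #G ∧ IsShift u v B S D G w with hGood
  obtain ⟨X, hX, hXmax⟩ := exists_max_image (C.powerset.filter Good) card
    ⟨∅, mem_filter.2 ⟨empty_mem_powerset _, by simp, ∅, empty_subset _, ∅, Subset.rfl, 0,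
      by simp, by simp, fun j hj => absurd hj (notMem_empty j)⟩⟩
  obtain ⟨hXC, hXQ, D, hD, G, hG, w, hDcard, hXG, hw⟩ := mem_filter.1 hX
  rw [mem_powerset] at hXC
  by_cases hbig : #C ≤ 4 * Q * #X
  · refine ⟨D, hD, G, hG.trans hXC, w, ?_, hbig.trans (Nat.mul_le_mul_left _ hXG), hw⟩
    refine le_of_mul_le_mul_right ?_ hCpos
    calc 2 * #D * #C = 2 * (#D * #C) := by ring
      _ ≤ 2 * (Q * #S * #X) := Nat.mul_le_mul_left _ hDcard
      _ = #S * (2 * Q * #X) := by ring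
      _ ≤ _ := Nat.mul_le_mul_left _ hXQ
  push Not at hbig
  have hU : (7 / 10 : ℝ) * #C < #(C \ X) := by
    have h1 : #(C \ X) + #X = #C := card_sdiff_add_card_eq_card hXC
    have h2 : 4 * #X ≤ 4 * Q * #X := by nlinarith
    have h3 : 7 * #C < 10 * #(C \ X) := by omega
    have h4 : (7 : ℝ) * #C < 10 * #(C \ X) := by exact_mod_cast h3
    linarith
  obtain ⟨τ, hτU, hτ, hi, hdeg⟩ := exists_cluster (Λ := Λ) (by exact_mod_cast hΛ) huvC hu
    (fun j hj => (hvC j hj).trans hB) sdiff_subset (fun j hj => (mem_filter.1 hj).2.1) hU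
  have hτC : τ ⊆ C := hτU.trans sdiff_subset
  obtain ⟨D', hD', G', hG', w', hDcard', hDS', hτG', hw'⟩ :=
    exists_cluster_shift hB huvC hu hvC hτC hτ hi hdeg hsmall
  -- A cluster this large suffices alone. Otherwise both `X` and `τ` are below `#C / (4 * Q)`, so `X
  -- ∪ τ` still satisfies `Good`, against maximality.
  by_cases hbig' : #C ≤ 4 * Q * #τ
  · exact ⟨D', hD', G', hG'.trans hτC, w', hDS', hbig'.trans (Nat.mul_le_mul_left _ hτG'), hw'⟩
  push Not at hbig'
  exfalso
  have hdisj : Disjoint X τ :=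
    disjoint_left.2 fun j hj hj' => (mem_sdiff.1 (hτU hj')).2 hj
  have hdisjG : Disjoint G G' := disjoint_of_subset_left hG (disjoint_of_subset_right hG' hdisj)
  have hcard : #(X ∪ τ) = #X + #τ := card_union_of_disjoint hdisj
  have hmem : X ∪ τ ∈ C.powerset.filter Good := by
    refine mem_filter.2 ⟨mem_powerset.2 (union_subset hXC hτC), ?_, D ∪ D', union_subset hD hD',
      G ∪ G', union_subset_union hG hG', fun j => if j ∈ τ then w' j else w j, ?_, ?_, ?_⟩
    · rw [hcard, mul_add]
      have h1 : 4 * Q * #X = 2 * (2 * Q * #X) := by ring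
      have h2 : 4 * Q * #τ = 2 * (2 * Q * #τ) := by ring
      omega
    · rw [hcard, mul_add]
      refine (Nat.mul_le_mul_right _ (card_union_le _ _)).trans ?_
      rw [add_mul]
      exact Nat.add_le_add hDcard hDcard'
    · rw [hcard, card_union_of_disjoint hdisjG, mul_add]
      exact Nat.add_le_add hXG hτG'
    · intro j hj
      by_cases hjτ : j ∈ τ
      · have hjG' : j ∈ G' := (mem_union.1 hj).resolve_left
          fun h => disjoint_left.1 hdisj (hG h) hjτ
        simp only [if_pos hjτ]
        exact ⟨(hw' j hjG').1, fun i hi hiD => (hw' j hjG').2 i hi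
          fun h => hiD (mem_union_right _ h)⟩
      · have hjG : j ∈ G := (mem_union.1 hj).resolve_right fun h => hjτ (hG' h)
        simp only [if_neg hjτ]
        exact ⟨(hw j hjG).1, fun i hi hiD => (hw j hjG).2 i hi
          fun h => hiD (mem_union_left _ h)⟩
  have := hXmax _ hmem
  have := hτ.card_pos
  omega

/-- A very sparse boolean matrix of bounded factorization norm contains a large zero rectangle. -/
lemma exists_zero_rectangle {Z : ι → κ → Prop} {u : ι → H} {Λ : ℕ} (hΛ : 0 < Λ) {n : ℕ}
    (hn : n ≤ 4 * Λ) {S : Finset ι} {T : Finset κ} {v : κ → H}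
    (huv : ∀ i ∈ S, ∀ j ∈ T, inner ℝ (u i) (v j) = if Z i j then 1 else 0)
    (hu : ∀ i ∈ S, ‖u i‖ ^ 2 ≤ 1) (hv : ∀ j ∈ T, ‖v j‖ ^ 2 ≤ n / 4)
    (he : edgeCount Z S T * (512 * Λ * (10 ^ 8 * Λ ^ 3) ^ n) ≤ #S * #T) :
    ∃ S' ⊆ S, ∃ T' ⊆ T, edgeCount Z S' T' = 0 ∧
      #S * #T ≤ 4 * (10 ^ 8 * Λ ^ 3) ^ n * (#S' * #T') := by
  induction n generalizing S T v with
  | zero =>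
    refine ⟨S, Subset.rfl, T, Subset.rfl, ?_, by simp; omega⟩
    refine sum_eq_zero fun i hi => card_eq_zero.2 (filter_eq_empty_iff.2 fun j hj hZ => ?_)
    have h1 := huv i hi j hj
    have h2 : v j = 0 := by
      have := hv j hj
      simp only [Nat.cast_zero, zero_div] at this
      exact norm_eq_zero.1 (pow_eq_zero_iff two_ne_zero |>.1 (le_antisymm this (sq_nonneg _)))
    rw [h2, inner_zero_right, if_pos hZ] at h1
    exact zero_ne_one h1
  | succ n ih =>
    set q := 10 ^ 8 * Λ ^ 3 with hq
    have hq1 : 1 ≤ q := Nat.one_le_iff_ne_zero.2 (by positivity)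
    rcases S.eq_empty_or_nonempty with rfl | hS
    · exact ⟨∅, Subset.rfl, ∅, empty_subset _, by simp [edgeCount], by simp⟩
    rcases T.eq_empty_or_nonempty with rfl | hT
    · exact ⟨∅, empty_subset _, ∅, Subset.rfl, by simp [edgeCount], by simp⟩
    have hB : ((n + 1 : ℕ) : ℝ) / 4 ≤ Λ := by
      have : ((n + 1 : ℕ) : ℝ) ≤ 4 * Λ := by exact_mod_cast hn
      linarith
    have he' : edgeCount Z S T * (512 * Λ) ≤ #S * #T :=
      le_trans (Nat.mul_le_mul_left _ (Nat.le_mul_of_pos_right _ (by positivity))) he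
    rcases sparse_step hΛ hB huv hu hv hS hT he' with ⟨T', hT', h1, h2⟩ |
      ⟨S', hS', T', hT', w, h1, h2, h3⟩
    · refine ⟨S, Subset.rfl, T', hT', h1, ?_⟩
      calc #S * #T ≤ #S * (4 * #T') := Nat.mul_le_mul_left _ h2
        _ = 4 * 1 * (#S * #T') := by ring
        _ ≤ _ := Nat.mul_le_mul_right _ (Nat.mul_le_mul_left _ (Nat.one_le_pow _ _ hq1))
    · have hmono : edgeCount Z S' T' ≤ edgeCount Z S T := by
        refine (sum_le_sum_of_subset hS').trans (sum_le_sum fun i _ => ?_)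
        exact card_le_card (filter_subset_filter _ hT')
      -- The vectors `v j - w j` still represent `Z` on `S' × T'` and their squared norm bound has
      -- dropped by `1 / 4`. The area shrinks by at most a factor `q`, which the power `q ^ (n + 1)`
      -- in the sparsity hypothesis absorbs.
      obtain ⟨S'', hS'', T'', hT'', h4, h5⟩ := ih (by omega) (S := S') (T := T')
        (v := fun j => v j - w j)
        (fun i hi j hj => by
          rw [inner_sub_right, h1 i hi j hj, sub_zero, huv i (hS' hi) j (hT' hj)])
        (fun i hi => hu i (hS' hi))
        (fun j hj => by have := h2 j hj; push_cast at this; linarith) (by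
          refine le_of_mul_le_mul_left ?_ (Nat.lt_of_lt_of_le zero_lt_one hq1)
          calc q * (edgeCount Z S' T' * (512 * Λ * q ^ n)) =
              edgeCount Z S' T' * (512 * Λ * q ^ (n + 1)) := by ring
            _ ≤ edgeCount Z S T * (512 * Λ * q ^ (n + 1)) := Nat.mul_le_mul_right _ hmono
            _ ≤ _ := he
            _ ≤ _ := h3)
      refine ⟨S'', hS''.trans hS', T'', hT''.trans hT', h4, h3.trans ?_⟩
      calc q * (#S' * #T') ≤ q * (4 * q ^ n * (#S'' * #T'')) := Nat.mul_le_mul_left _ h5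
        _ = _ := by ring

end Sparse

/-! ### All-ones rectangles in dense matrices, with explicit bounds -/

section Rectangle

variable {ι κ : Type*}

lemma edgeCount_le_card_mul_card (E : ι → κ → Prop) (S : Finset ι) (T : Finset κ) :
    edgeCount E S T ≤ #S * #T := by
  rw [← smul_eq_mul, ← sum_const]
  exact sum_le_sum fun i _ => card_filter_le _ _

/-- One extra coordinate represents the complement `1 - ⟪u, v⟫`. Rescaling by `√(L + 1)` makes the
row vectors of norm at most `1` and the squared column norms at most `Λ = (L + 1) ^ 2`, so `n = 4 *
Λ` rounds are available. -/
lemma exists_complement_zero_rectangle {t L : ℕ} {S : Finset ι} {T : Finset κ}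
    {E : ι → κ → Prop} {u : ι → Fin t → ℝ} {v : κ → Fin t → ℝ}
    (huv : ∀ i ∈ S, ∀ j ∈ T, ∑ k, u i k * v j k = if E i j then 1 else 0)
    (hu : ∀ i ∈ S, ∑ k, u i k ^ 2 ≤ L) (hv : ∀ j ∈ T, ∑ k, v j k ^ 2 ≤ L)
    (he : edgeCount (fun i j => ¬ E i j) S T *
      (512 * (L + 1) ^ 2 * (10 ^ 8 * ((L + 1) ^ 2) ^ 3) ^ (4 * (L + 1) ^ 2)) ≤ #S * #T) :
    ∃ S' ⊆ S, ∃ T' ⊆ T, edgeCount (fun i j => ¬ E i j) S' T' = 0 ∧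
      #S * #T ≤ 4 * (10 ^ 8 * ((L + 1) ^ 2) ^ 3) ^ (4 * (L + 1) ^ 2) * (#S' * #T') := by
  set c : ℝ := Real.sqrt (L + 1) with hc
  have hc2 : c ^ 2 = L + 1 := Real.sq_sqrt (by positivity)
  have hc0 : 0 < c := Real.sqrt_pos.2 (by positivity)
  set u' : ι → EuclideanSpace ℝ (Fin (t + 1)) :=
    fun i => WithLp.toLp 2 (Fin.cons (1 / c) fun k => u i k / c) with hu'
  set v' : κ → EuclideanSpace ℝ (Fin (t + 1)) :=
    fun j => WithLp.toLp 2 (Fin.cons c fun k => -(c * v j k)) with hv'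
  refine exists_zero_rectangle (u := u') (v := v') (Λ := (L + 1) ^ 2) (by positivity) le_rfl
    (fun i hi j hj => ?_) (fun i hi => ?_) (fun j hj => ?_) he
  · have h1 : inner ℝ (u' i) (v' j) = 1 - ∑ k, u i k * v j k := by
      simp only [hu', hv', PiLp.inner_apply, Fin.sum_univ_succ, Fin.cons_zero, Fin.cons_succ,
        RCLike.inner_apply, conj_trivial]
      rw [mul_one_div_cancel hc0.ne', sub_eq_add_neg, ← sum_neg_distrib]
      congr 1
      refine sum_congr rfl fun k _ => ?_
      field_simp
    rw [h1, huv i hi j hj]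
    by_cases h : E i j <;> simp [h]
  · have h1 : ‖u' i‖ ^ 2 = (1 + ∑ k, u i k ^ 2) / c ^ 2 := by
      rw [EuclideanSpace.real_norm_sq_eq, Fin.sum_univ_succ]
      simp only [hu', Fin.cons_zero, Fin.cons_succ, div_pow, one_pow]
      rw [← sum_div, ← add_div]
    rw [h1, hc2, div_le_one (by positivity)]
    linarith [hu i hi]
  · have h1 : ‖v' j‖ ^ 2 = c ^ 2 * (1 + ∑ k, v j k ^ 2) := by
      rw [EuclideanSpace.real_norm_sq_eq, Fin.sum_univ_succ]
      simp only [hv', Fin.cons_zero, Fin.cons_succ, neg_sq, mul_pow]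
      rw [← mul_sum, mul_add, mul_one]
    rw [h1, hc2]
    push_cast
    have := hv j hj
    have hL : (0 : ℝ) ≤ L := by positivity
    nlinarith

/-- A dense boolean matrix of bounded factorization norm contains a large all-ones rectangle. -/
lemma exists_allOnes_rectangle {t L : ℕ} (hL : 0 < L) {S : Finset ι} {T : Finset κ}
    {E : ι → κ → Prop} {u : ι → Fin t → ℝ} {v : κ → Fin t → ℝ}
    (huv : ∀ i ∈ S, ∀ j ∈ T, ∑ k, u i k * v j k = if E i j then 1 else 0)
    (hu : ∀ i ∈ S, ∑ k, u i k ^ 2 ≤ L) (hv : ∀ j ∈ T, ∑ k, v j k ^ 2 ≤ L)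
    {N M p : ℕ} (hN : 0 < N) (hST : #S * #T ≤ N) (hdense : N ≤ M * edgeCount E S T)
    (hp : M * (512 * (L + 1) ^ 2 * (10 ^ 8 * ((L + 1) ^ 2) ^ 3) ^ (4 * (L + 1) ^ 2)) ≤ 2 ^ p) :
    ∃ S' ⊆ S, ∃ T' ⊆ T, edgeCount (fun i j => ¬ E i j) S' T' = 0 ∧
      N ≤ M * (800 * L ^ 2) ^ (100 * L ^ 2 * p) *
        (4 * (10 ^ 8 * ((L + 1) ^ 2) ^ 3) ^ (4 * (L + 1) ^ 2)) * (#S' * #T') := by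
  have he : 0 < edgeCount E S T := Nat.pos_of_ne_zero fun h => by
    rw [h, mul_zero] at hdense; omega
  have hL1 : (1 : ℝ) ≤ L := by exact_mod_cast hL
  obtain ⟨S', hS', T', hT', h1, h2⟩ := boost_iterate hL1 huv hu hv he (100 * L ^ 2 * p)
  set W := 512 * (L + 1) ^ 2 * (10 ^ 8 * ((L + 1) ^ 2) ^ 3) ^ (4 * (L + 1) ^ 2) with hW
  have he' : (0 : ℝ) < edgeCount E S T := by exact_mod_cast he
  have hz : edgeCount (fun i j => ¬ E i j) S' T' * W ≤ #S' * #T' := by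
    -- By Bernoulli's inequality, `100 * L ^ 2` boosts at least halve the ratio of zeros to ones.
    have hpow : (2 : ℝ) ^ p ≤ (1 + 1 / (100 * (L : ℝ) ^ 2)) ^ (100 * L ^ 2 * p) := by
      rw [pow_mul]
      refine pow_le_pow_left₀ (by norm_num) ?_ p
      have h3 := one_add_mul_le_pow (a := 1 / (100 * (L : ℝ) ^ 2))
        (le_trans (by norm_num) (by positivity : (0 : ℝ) ≤ _)) (100 * L ^ 2)
      refine le_trans (le_of_eq ?_) h3
      push_cast
      rw [mul_one_div_cancel (by positivity)]
      norm_num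
    have h3 : (edgeCount (fun i j => ¬ E i j) S' T' : ℝ) * 2 ^ p ≤ M * (#S' * #T') := by
      have h4 : (edgeCount (fun i j => ¬ E i j) S T : ℝ) ≤ M * edgeCount E S T := by
        exact_mod_cast ((edgeCount_le_card_mul_card _ S T).trans hST).trans hdense
      refine le_of_mul_le_mul_right ?_ he'
      calc _ ≤ (edgeCount (fun i j => ¬ E i j) S' T' : ℝ) *
            (1 + 1 / (100 * (L : ℝ) ^ 2)) ^ (100 * L ^ 2 * p) * edgeCount E S T := by gcongr
        _ ≤ _ := h2
        _ ≤ M * edgeCount E S T * (#S' * #T') := by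
          refine mul_le_mul h4 ?_ (Nat.cast_nonneg _) (by positivity)
          exact_mod_cast edgeCount_le_card_mul_card E S' T'
        _ = _ := by ring
    have h4 : edgeCount (fun i j => ¬ E i j) S' T' * 2 ^ p ≤ M * (#S' * #T') := by
      exact_mod_cast h3
    have hM : 0 < M := Nat.pos_of_ne_zero fun h => by rw [h, zero_mul] at hdense; omega
    refine le_of_mul_le_mul_left ?_ hM
    calc M * (edgeCount (fun i j => ¬ E i j) S' T' * W) =
          edgeCount (fun i j => ¬ E i j) S' T' * (M * W) := by ring
      _ ≤ edgeCount (fun i j => ¬ E i j) S' T' * 2 ^ p := Nat.mul_le_mul_left _ hp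
      _ ≤ _ := h4
  obtain ⟨S'', hS'', T'', hT'', h3, h4⟩ := exists_complement_zero_rectangle
    (fun i hi j hj => huv i (hS' hi) j (hT' hj)) (fun i hi => hu i (hS' hi))
    (fun j hj => hv j (hT' hj)) hz
  refine ⟨S'', hS''.trans hS', T'', hT''.trans hT', h3, ?_⟩
  have h5 : edgeCount E S T ≤ (800 * L ^ 2) ^ (100 * L ^ 2 * p) * (#S' * #T') := by
    rw [one_div, inv_pow, ← div_eq_mul_inv, div_le_iff₀ (by positivity)] at h1
    have h6 : edgeCount E S T ≤ edgeCount E S' T' * (800 * L ^ 2) ^ (100 * L ^ 2 * p) := by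
      exact_mod_cast h1
    rw [mul_comm]
    exact h6.trans (Nat.mul_le_mul_right _ (edgeCount_le_card_mul_card E S' T'))
  calc N ≤ M * edgeCount E S T := hdense
    _ ≤ M * ((800 * L ^ 2) ^ (100 * L ^ 2 * p) * (#S' * #T')) := Nat.mul_le_mul_left _ h5
    _ ≤ M * ((800 * L ^ 2) ^ (100 * L ^ 2 * p) *
        (4 * (10 ^ 8 * ((L + 1) ^ 2) ^ 3) ^ (4 * (L + 1) ^ 2) * (#S'' * #T''))) :=
      Nat.mul_le_mul_left _ (Nat.mul_le_mul_left _ h4)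
    _ = _ := by ring

lemma mul_pow_le_two_pow {c k x L : ℕ} (hL : 0 < L) (hx : x ≤ 2 ^ c * L ^ k) :
    x ≤ 2 ^ ((c + k) * L) := by
  refine hx.trans ?_
  rw [add_mul, pow_add]
  refine Nat.mul_le_mul (Nat.pow_le_pow_right two_pos (Nat.le_mul_of_pos_right _ hL)) ?_
  rw [mul_comm, pow_mul]
  exact Nat.pow_le_pow_left Nat.lt_two_pow_self.le _

lemma zero_rectangle_factor_le {L : ℕ} (hL : 0 < L) :
    (10 ^ 8 * ((L + 1) ^ 2) ^ 3) ^ (4 * (L + 1) ^ 2) ≤ 2 ^ (624 * L ^ 3) := by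
  have h0 : (L + 1) ^ 2 ≤ 4 * L ^ 2 := by nlinarith
  have h1 : 10 ^ 8 * ((L + 1) ^ 2) ^ 3 ≤ 2 ^ (39 * L) := by
    refine mul_pow_le_two_pow (c := 33) (k := 6) hL ?_
    calc 10 ^ 8 * ((L + 1) ^ 2) ^ 3 ≤ 10 ^ 8 * (4 * L ^ 2) ^ 3 := by gcongr
      _ = 64 * 10 ^ 8 * L ^ 6 := by ring
      _ ≤ _ := Nat.mul_le_mul_right _ (by norm_num)
  refine (Nat.pow_le_pow_left h1 _).trans ?_
  rw [← pow_mul]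
  refine Nat.pow_le_pow_right two_pos ?_
  calc 39 * L * (4 * (L + 1) ^ 2) ≤ 39 * L * (4 * (4 * L ^ 2)) := by gcongr
    _ = _ := by ring

lemma boost_exponent_bound {L : ℕ} (hL : 0 < L) :
    8 * L ^ 2 * (38400 * L ^ 2) ^ 2 *
      (512 * (L + 1) ^ 2 * (10 ^ 8 * ((L + 1) ^ 2) ^ 3) ^ (4 * (L + 1) ^ 2)) ≤
      2 ^ (677 * L ^ 3) := by
  have h0 : (L + 1) ^ 2 ≤ 4 * L ^ 2 := by nlinarith
  have h1 : 8 * L ^ 2 * (38400 * L ^ 2) ^ 2 ≤ 2 ^ (40 * L) := by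
    refine mul_pow_le_two_pow (c := 34) (k := 6) hL ?_
    calc _ = 8 * 38400 ^ 2 * L ^ 6 := by ring
      _ ≤ _ := Nat.mul_le_mul_right _ (by norm_num)
  have h2 : 512 * (L + 1) ^ 2 ≤ 2 ^ (13 * L) := by
    refine mul_pow_le_two_pow (c := 11) (k := 2) hL ?_
    calc _ ≤ 512 * (4 * L ^ 2) := by gcongr
      _ = _ := by ring
  refine (Nat.mul_le_mul h1 (Nat.mul_le_mul h2 (zero_rectangle_factor_le hL))).trans ?_
  rw [← pow_add, ← pow_add]
  refine Nat.pow_le_pow_right two_pos ?_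
  have : L ≤ L ^ 3 := Nat.le_self_pow (by norm_num) L
  omega

lemma rectangle_factor_le {L : ℕ} (hL : 0 < L) :
    8 * L ^ 2 * (38400 * L ^ 2) ^ 2 * (800 * L ^ 2) ^ (100 * L ^ 2 * (677 * L ^ 3)) *
        (4 * (10 ^ 8 * ((L + 1) ^ 2) ^ 3) ^ (4 * (L + 1) ^ 2)) ≤ 2 ^ (820000 * L ^ 6) := by
  have h1 : 8 * L ^ 2 * (38400 * L ^ 2) ^ 2 ≤ 2 ^ (40 * L) := by
    refine mul_pow_le_two_pow (c := 34) (k := 6) hL ?_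
    calc _ = 8 * 38400 ^ 2 * L ^ 6 := by ring
      _ ≤ _ := Nat.mul_le_mul_right _ (by norm_num)
  have h2 : 800 * L ^ 2 ≤ 2 ^ (12 * L) :=
    mul_pow_le_two_pow (c := 10) (k := 2) hL (Nat.mul_le_mul_right _ (by norm_num))
  have h3 := Nat.pow_le_pow_left h2 (100 * L ^ 2 * (677 * L ^ 3))
  rw [← pow_mul] at h3
  have h4 : 4 * (10 ^ 8 * ((L + 1) ^ 2) ^ 3) ^ (4 * (L + 1) ^ 2) ≤ 2 ^ (2 + 624 * L ^ 3) := by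
    rw [pow_add]
    exact Nat.mul_le_mul_left _ (zero_rectangle_factor_le hL)
  refine (Nat.mul_le_mul (Nat.mul_le_mul h1 h3) h4).trans ?_
  rw [← pow_add, ← pow_add]
  refine Nat.pow_le_pow_right two_pos ?_
  have e1 : L ≤ L ^ 6 := Nat.le_self_pow (by norm_num) L
  have e2 : L ^ 3 ≤ L ^ 6 := Nat.pow_le_pow_right hL (by norm_num)
  have e3 : 1 ≤ L ^ 6 := Nat.one_le_pow _ _ hL
  have e4 : 12 * L * (100 * L ^ 2 * (677 * L ^ 3)) = 812400 * L ^ 6 := by ring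
  omega

end Rectangle

/-! ### Greedy extraction of disjoint rectangles -/

section Greedy

variable {ι κ : Type*}

lemma rowDeg_mono {E : ι → κ → Prop} {C C' : Finset κ} (h : C' ⊆ C) (i : ι) :
    rowDeg E C' i ≤ rowDeg E C i :=
  card_le_card (filter_subset_filter _ h)

lemma colDeg_mono {E : ι → κ → Prop} {R R' : Finset ι} (h : R' ⊆ R) (j : κ) :
    colDeg E R' j ≤ colDeg E R j :=
  card_le_card (filter_subset_filter _ h)

/-- A graph with bounded factorization norm contains a complete bipartite graph meeting few edges
in proportion to its size. -/
lemma exists_cheap_rectangle {t L : ℕ} (hL : 0 < L) {R : Finset ι} {C : Finset κ}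
    {E : ι → κ → Prop} {u : ι → Fin t → ℝ} {v : κ → Fin t → ℝ}
    (huv : ∀ i ∈ R, ∀ j ∈ C, ∑ k, u i k * v j k = if E i j then 1 else 0)
    (hu : ∀ i ∈ R, ∑ k, u i k ^ 2 ≤ L) (hv : ∀ j ∈ C, ∑ k, v j k ^ 2 ≤ L)
    (he : 0 < edgeCount E R C) :
    ∃ S ⊆ R, ∃ T ⊆ C, 0 < #S * #T ∧ (∀ i ∈ S, ∀ j ∈ T, E i j) ∧
      ∑ i ∈ S, rowDeg E C i + ∑ j ∈ T, colDeg E R j ≤ 2 ^ (10 ^ 6 * L ^ 6) * (#S * #T) := by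
  set u' : ι → EuclideanSpace ℝ (Fin t) := fun i => WithLp.toLp 2 (u i) with hu'
  set v' : κ → EuclideanSpace ℝ (Fin t) := fun j => WithLp.toLp 2 (v j) with hv'
  have huv' : ∀ i ∈ R, ∀ j ∈ C, inner ℝ (u' i) (v' j) = if E i j then (1 : ℝ) else 0 := by
    intro i hi j hj
    rw [← huv i hi j hj]
    simp only [hu', hv', PiLp.inner_apply, RCLike.inner_apply, conj_trivial]
    exact sum_congr rfl fun k _ => mul_comm _ _
  have hu'' : ∀ i ∈ R, ‖u' i‖ ^ 2 ≤ L := fun i hi => by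
    rw [EuclideanSpace.real_norm_sq_eq]; exact hu i hi
  have hv'' : ∀ j ∈ C, ‖v' j‖ ^ 2 ≤ L := fun j hj => by
    rw [EuclideanSpace.real_norm_sq_eq]; exact hv j hj
  obtain ⟨R', hR', C', hC', a, b, hab, ha, hb, hRa, hCb, he'⟩ :=
    exists_regular_block hL huv' hu'' hv'' he
  obtain ⟨i₀, hi₀, j₀, hj₀, hE, hdense⟩ := exists_edge_dense_neighbourhoods hL
    (by positivity : 0 < 38400 * L ^ 2) hab (fun i hi j hj => huv' i (hR' hi) j (hC' hj))
    (fun i hi => hu'' i (hR' hi)) (fun j hj => hv'' j (hC' hj))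
    (fun i hi => (rowDeg_mono hC' i).trans (ha i hi))
    (fun j hj => (colDeg_mono hR' j).trans (hb j hj)) hRa hCb he'
  set S₀ : Finset ι := R'.filter fun i' => E i' j₀ with hS₀
  set T₀ : Finset κ := C'.filter fun j' => E i₀ j' with hT₀
  have hS₀R : S₀ ⊆ R' := filter_subset _ _
  have hT₀C : T₀ ⊆ C' := filter_subset _ _
  have hSb : #S₀ ≤ b := (colDeg_mono hR' j₀).trans (hb j₀ hj₀)
  have hTa : #T₀ ≤ a := (rowDeg_mono hC' i₀).trans (ha i₀ hi₀)
  obtain ⟨S, hS, T, hT, hzero, hbig⟩ := exists_allOnes_rectangle hL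
    (fun i hi j hj => huv i (hR' (hS₀R hi)) j (hC' (hT₀C hj)))
    (fun i hi => hu i (hR' (hS₀R hi))) (fun j hj => hv j (hC' (hT₀C hj))) hab
    (by rw [mul_comm]; exact Nat.mul_le_mul hTa hSb) hdense (boost_exponent_bound hL)
  replace hbig := hbig.trans (Nat.mul_le_mul_right _ (rectangle_factor_le hL))
  set K := 2 ^ (820000 * L ^ 6) with hK
  have ha0 : 0 < a := Nat.pos_of_mul_pos_right hab
  have hb0 : 0 < b := Nat.pos_of_mul_pos_left hab
  have hST : 0 < #S * #T := Nat.pos_of_ne_zero fun h => by rw [h, mul_zero] at hbig; omega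
  refine ⟨S, hS.trans (hS₀R.trans hR'), T, hT.trans (hT₀C.trans hC'), hST, fun i hi j hj => ?_, ?_⟩
  · by_contra h
    have h1 := sum_eq_zero_iff.1 hzero i hi
    simp only [rowDeg, card_eq_zero, filter_eq_empty_iff] at h1
    exact h1 hj h
  -- From `#S ≤ b`, `#T ≤ a` and `a * b ≤ K * #S * #T`, each side is nearly as large as possible. As
  -- `a` and `b` bound degrees in the whole graph, `S` and `T` meet at most `#S * a + #T * b` edges.
  · have h1 : a ≤ K * #T := by
      refine le_of_mul_le_mul_right (hbig.trans ?_) hb0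
      calc K * (#S * #T) = K * #T * #S := by ring
        _ ≤ _ := Nat.mul_le_mul_left _ ((card_le_card hS).trans hSb)
    have h2 : b ≤ K * #S := by
      refine le_of_mul_le_mul_left (hbig.trans ?_) ha0
      calc K * (#S * #T) = #T * (K * #S) := by ring
        _ ≤ _ := Nat.mul_le_mul_right _ ((card_le_card hT).trans hTa)
    have h3 : ∑ i ∈ S, rowDeg E C i ≤ #S * a := by
      rw [← smul_eq_mul]
      exact sum_le_card_nsmul _ _ _ fun i hi => ha i (hS₀R (hS hi))
    have h4 : ∑ j ∈ T, colDeg E R j ≤ #T * b := by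
      rw [← smul_eq_mul]
      exact sum_le_card_nsmul _ _ _ fun j hj => hb j (hT₀C (hT hj))
    have h5 : 2 * K ≤ 2 ^ (10 ^ 6 * L ^ 6) := by
      rw [hK, ← pow_succ']
      refine Nat.pow_le_pow_right two_pos ?_
      have := Nat.one_le_pow 6 L hL
      omega
    calc _ ≤ #S * (K * #T) + #T * (K * #S) :=
          Nat.add_le_add (h3.trans (Nat.mul_le_mul_left _ h1)) (h4.trans (Nat.mul_le_mul_left _ h2))
      _ = 2 * K * (#S * #T) := by ring
      _ ≤ _ := Nat.mul_le_mul_right _ h5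

lemma edgeCount_le_sdiff (E : ι → κ → Prop) {R S : Finset ι} {C T : Finset κ} (hS : S ⊆ R)
    (hT : T ⊆ C) : edgeCount E R C ≤
      ∑ i ∈ S, rowDeg E C i + ∑ j ∈ T, colDeg E R j + edgeCount E (R \ S) (C \ T) := by
  have h1 : edgeCount E R C = edgeCount E (R \ S) C + ∑ i ∈ S, rowDeg E C i :=
    (sum_sdiff hS).symm
  have h2 : edgeCount E (R \ S) C = edgeCount E (R \ S) (C \ T) + ∑ j ∈ T, colDeg E (R \ S) j := by
    rw [edgeCount_eq_sum_colDeg, edgeCount_eq_sum_colDeg]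
    exact (sum_sdiff hT).symm
  have h3 : ∑ j ∈ T, colDeg E (R \ S) j ≤ ∑ j ∈ T, colDeg E R j :=
    sum_le_sum fun j _ => colDeg_mono sdiff_subset j
  omega

/-- A fixed proportion of the edges of a graph with bounded factorization norm is covered by
complete bipartite graphs with disjoint sides. -/
lemma exists_disjoint_rectangles {t L : ℕ} (hL : 0 < L) {R : Finset ι} {C : Finset κ}
    {E : ι → κ → Prop} {u : ι → Fin t → ℝ} {v : κ → Fin t → ℝ}
    (huv : ∀ i ∈ R, ∀ j ∈ C, ∑ k, u i k * v j k = if E i j then 1 else 0)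
    (hu : ∀ i ∈ R, ∑ k, u i k ^ 2 ≤ L) (hv : ∀ j ∈ C, ∑ k, v j k ^ 2 ≤ L) :
    ∃ (k : ℕ) (S : Fin k → Finset ι) (T : Fin k → Finset κ),
      (∀ l, S l ⊆ R ∧ T l ⊆ C) ∧ (∀ a b, a ≠ b → Disjoint (S a) (S b)) ∧
      (∀ a b, a ≠ b → Disjoint (T a) (T b)) ∧ (∀ l, ∀ i ∈ S l, ∀ j ∈ T l, E i j) ∧
      edgeCount E R C ≤ 2 ^ (10 ^ 6 * L ^ 6) * ∑ l, #(S l) * #(T l) := by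
  induction hn : #R using Nat.strong_induction_on generalizing R C with
  | _ n ih =>
  rcases Nat.eq_zero_or_pos (edgeCount E R C) with he | he
  · exact ⟨0, Fin.elim0, Fin.elim0, fun l => l.elim0, fun l => l.elim0, fun l => l.elim0,
      fun l => l.elim0, by simp [he]⟩
  obtain ⟨S₀, hS₀, T₀, hT₀, hpos, hall, hcheap⟩ := exists_cheap_rectangle hL huv hu hv he
  have hlt : #(R \ S₀) < n := by
    rw [← hn]
    refine card_lt_card (sdiff_ssubset hS₀ (card_pos.1 (Nat.pos_of_mul_pos_right hpos)))
  obtain ⟨k, S, T, hsub, hdS, hdT, hE, hcov⟩ := ih _ hlt (R := R \ S₀) (C := C \ T₀)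
    (fun i hi j hj => huv i (sdiff_subset hi) j (sdiff_subset hj))
    (fun i hi => hu i (sdiff_subset hi)) (fun j hj => hv j (sdiff_subset hj)) rfl
  have hS0 : ∀ l, Disjoint S₀ (S l) := fun l =>
    disjoint_of_subset_right (hsub l).1 disjoint_sdiff
  have hT0 : ∀ l, Disjoint T₀ (T l) := fun l =>
    disjoint_of_subset_right (hsub l).2 disjoint_sdiff
  refine ⟨k + 1, Fin.cons S₀ S, Fin.cons T₀ T, ?_, ?_, ?_, ?_, ?_⟩
  · exact Fin.cases ⟨hS₀, hT₀⟩ fun l =>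
      ⟨(hsub l).1.trans sdiff_subset, (hsub l).2.trans sdiff_subset⟩
  · refine Fin.cases (Fin.cases (fun h => absurd rfl h) fun l _ => hS0 l) fun a =>
      Fin.cases (fun _ => (hS0 a).symm) fun b h => hdS a b fun hab => h (congrArg _ hab)
  · refine Fin.cases (Fin.cases (fun h => absurd rfl h) fun l _ => hT0 l) fun a =>
      Fin.cases (fun _ => (hT0 a).symm) fun b h => hdT a b fun hab => h (congrArg _ hab)
  · exact Fin.cases hall hE
  · rw [Fin.sum_univ_succ, mul_add]
    simp only [Fin.cons_zero, Fin.cons_succ]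
    exact (edgeCount_le_sdiff E hS₀ hT₀).trans (Nat.add_le_add hcheap hcov)

end Greedy

/-! ### From `gammaTwo` to balanced vectors -/

section Factorization

lemma sum_sq_le_maxRowNorm_sq {m t : ℕ} (U : Matrix (Fin m) (Fin t) ℝ) (i : Fin m) :
    ∑ k, U i k ^ 2 ≤ maxRowNorm U ^ 2 := by
  have h1 : Real.sqrt (∑ k, U i k ^ 2) ≤ maxRowNorm U :=
    le_ciSup (f := fun i => Real.sqrt (∑ k, U i k ^ 2)) (Set.finite_range _).bddAbove i
  exact (Real.sqrt_le_left ((Real.sqrt_nonneg _).trans h1)).1 h1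

lemma sum_sq_le_maxColNorm_sq {t n : ℕ} (V : Matrix (Fin t) (Fin n) ℝ) (j : Fin n) :
    ∑ k, V k j ^ 2 ≤ maxColNorm V ^ 2 :=
  sum_sq_le_maxRowNorm_sq V.transpose j

lemma maxRowNorm_nonneg {m t : ℕ} (U : Matrix (Fin m) (Fin t) ℝ) : 0 ≤ maxRowNorm U :=
  Real.iSup_nonneg fun _ => Real.sqrt_nonneg _

lemma maxColNorm_nonneg {t n : ℕ} (V : Matrix (Fin t) (Fin n) ℝ) : 0 ≤ maxColNorm V :=
  Real.iSup_nonneg fun _ => Real.sqrt_nonneg _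

lemma abs_mul_apply_le {m t n : ℕ} (U : Matrix (Fin m) (Fin t) ℝ) (V : Matrix (Fin t) (Fin n) ℝ)
    (i : Fin m) (j : Fin n) : |(U * V) i j| ≤ maxRowNorm U * maxColNorm V := by
  refine abs_le_of_sq_le_sq ?_ (mul_nonneg (maxRowNorm_nonneg U) (maxColNorm_nonneg V))
  rw [Matrix.mul_apply, mul_pow]
  exact (sum_mul_sq_le_sq_mul_sq univ (U i) fun k => V k j).trans (mul_le_mul
    (sum_sq_le_maxRowNorm_sq U i) (sum_sq_le_maxColNorm_sq V j) (sum_nonneg fun _ _ => sq_nonneg _)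
    (sq_nonneg _))

lemma gammaTwo_set_nonempty {m n : ℕ} (A : Matrix (Fin m) (Fin n) ℝ) :
    {c : ℝ | ∃ (t : ℕ) (U : Matrix (Fin m) (Fin t) ℝ) (V : Matrix (Fin t) (Fin n) ℝ),
      A = U * V ∧ c = maxRowNorm U * maxColNorm V}.Nonempty :=
  ⟨_, n, A, 1, (Matrix.mul_one A).symm, rfl⟩

lemma one_le_gammaTwo {m n : ℕ} {A : Matrix (Fin m) (Fin n) ℝ} {i : Fin m} {j : Fin n}
    (h : A i j = 1) : 1 ≤ gammaTwo A := by
  refine le_csInf (gammaTwo_set_nonempty A) ?_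
  rintro c ⟨t, U, V, rfl, rfl⟩
  have := abs_mul_apply_le U V i j
  rwa [h, abs_one] at this

/-- A near-optimal factorization can be balanced so that all vectors have small norm. -/
lemma exists_balanced_vectors {m n : ℕ} {A : Matrix (Fin m) (Fin n) ℝ} {i₀ : Fin m} {j₀ : Fin n}
    (h : A i₀ j₀ = 1) {c : ℝ} (hc : gammaTwo A < c) :
    ∃ (t : ℕ) (u : Fin m → Fin t → ℝ) (v : Fin n → Fin t → ℝ),
      (∀ i j, ∑ k, u i k * v j k = A i j) ∧ (∀ i, ∑ k, u i k ^ 2 ≤ c) ∧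
      ∀ j, ∑ k, v j k ^ 2 ≤ c := by
  obtain ⟨_, ⟨t, U, V, rfl, rfl⟩, hlt⟩ := exists_lt_of_csInf_lt (gammaTwo_set_nonempty A) hc
  have h1 := abs_mul_apply_le U V i₀ j₀
  rw [h, abs_one] at h1
  have hU : 0 < maxRowNorm U := lt_of_le_of_ne (maxRowNorm_nonneg U) fun h0 => by
    rw [← h0, zero_mul] at h1; linarith
  have hV : 0 < maxColNorm V := lt_of_le_of_ne (maxColNorm_nonneg V) fun h0 => by
    rw [← h0, mul_zero] at h1; linarith
  set s : ℝ := Real.sqrt (maxColNorm V / maxRowNorm U) with hs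
  have hs0 : 0 < s := Real.sqrt_pos.2 (by positivity)
  have hs2 : s ^ 2 = maxColNorm V / maxRowNorm U := Real.sq_sqrt (by positivity)
  refine ⟨t, fun i k => s * U i k, fun j k => V k j / s, fun i j => ?_, fun i => ?_, fun j => ?_⟩
  · rw [Matrix.mul_apply]
    exact sum_congr rfl fun k _ => by field_simp
  · simp only [mul_pow, ← mul_sum]
    refine le_trans ?_ hlt.le
    rw [hs2]
    calc _ ≤ maxColNorm V / maxRowNorm U * maxRowNorm U ^ 2 :=
          mul_le_mul_of_nonneg_left (sum_sq_le_maxRowNorm_sq U i) (by positivity)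
      _ = _ := by field_simp
  · simp only [div_pow, ← sum_div]
    refine le_trans ?_ hlt.le
    rw [hs2]
    calc _ ≤ maxColNorm V ^ 2 / (maxColNorm V / maxRowNorm U) :=
          div_le_div_of_nonneg_right (sum_sq_le_maxColNorm_sq V j) (by positivity)
      _ = _ := by field_simp

lemma numOnes_eq_edgeCount {m n : ℕ} (A : Matrix (Fin m) (Fin n) ℝ) :
    numOnes A = edgeCount (fun i j => A i j = 1) univ univ := by
  rw [numOnes, card_filter, Fintype.sum_prod_type]
  simp only [edgeCount, rowDeg, card_filter]

/-- `10 ^ 6 * L ^ 6 ≤ 2 ^ (26 * L)`, and `26 * (lam + 2) ≤ 78 * lam` since `lam ≥ 1`. -/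
lemma two_pow_bound {L : ℕ} {lam : ℝ} (hlam : 1 ≤ lam) (hL : (L : ℝ) ≤ lam + 2) :
    (2 : ℝ) ^ (10 ^ 6 * L ^ 6) ≤ (2 : ℝ) ^ ((2 : ℝ) ^ (100 * lam)) := by
  rcases Nat.eq_zero_or_pos L with rfl | hL0
  · simpa using Real.one_le_rpow one_le_two (Real.rpow_nonneg zero_le_two _)
  rw [← Real.rpow_natCast]
  refine Real.rpow_le_rpow_of_exponent_le one_le_two ?_
  have h1 : 10 ^ 6 * L ^ 6 ≤ 2 ^ ((20 + 6) * L) :=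
    mul_pow_le_two_pow hL0 (Nat.mul_le_mul_right _ (by norm_num))
  have h2 : ((10 ^ 6 * L ^ 6 : ℕ) : ℝ) ≤ (2 : ℝ) ^ ((20 + 6) * L) := by exact_mod_cast h1
  refine h2.trans ?_
  rw [← Real.rpow_natCast]
  refine Real.rpow_le_rpow_of_exponent_le one_le_two ?_
  push_cast
  linarith

end Factorization

end

theorem theorem1p4 :
    ∃ C : ℝ, 0 < C ∧
      ∀ (m n : ℕ) (A : Matrix (Fin m) (Fin n) ℝ) (lam : ℝ),
        IsBoolean A → gammaTwo A ≤ lam →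
          ∃ B : Matrix (Fin m) (Fin n) ℝ,
            IsBlocky B ∧
            (numOnes A : ℝ) / (2 : ℝ) ^ ((2 : ℝ) ^ (C * lam)) ≤ (numOnes B : ℝ) ∧
            ∀ i j, B i j = 1 → A i j = 1 := by
  classical
  refine ⟨100, by norm_num, fun m n A lam hA hlam => ?_⟩
  by_cases hone : ∃ i j, A i j = 1
  swap
  · push Not at hone
    refine ⟨0, ⟨fun i j => Or.inl rfl, 0, Fin.elim0, Fin.elim0, fun l => l.elim0,
      fun l => l.elim0, by simp⟩, ?_, fun i j h => absurd h (by simp)⟩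
    have : numOnes A = 0 := by simp [numOnes, hone]
    rw [this]
    simp
  obtain ⟨i₀, j₀, h1⟩ := hone
  have hlam1 : 1 ≤ lam := (one_le_gammaTwo h1).trans hlam
  -- The extra `1` makes `gammaTwo A < L` strict, so a factorization exists without the infimum
  -- having to be attained.
  set L : ℕ := ⌈lam⌉₊ + 1 with hL
  have hlamL : lam + 1 ≤ L := by
    rw [hL]; push_cast; linarith [Nat.le_ceil lam]
  have hLlam : (L : ℝ) ≤ lam + 2 := by
    rw [hL]; push_cast; linarith [Nat.ceil_lt_add_one (by linarith : 0 ≤ lam)]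
  obtain ⟨t, u, v, huv, hu, hv⟩ := exists_balanced_vectors h1 (by linarith : gammaTwo A < L)
  obtain ⟨k, S, T, -, hdS, hdT, hE, hcov⟩ := exists_disjoint_rectangles (L := L) (by omega)
    (R := Finset.univ) (C := Finset.univ) (E := fun i j => A i j = 1) (u := u) (v := v)
    (fun i _ j _ => by
      rw [huv]
      rcases hA i j with h | h <;> simp [h]) (fun i _ => hu i) (fun j _ => hv j)
  set B : Matrix (Fin m) (Fin n) ℝ := fun i j => if ∃ l, i ∈ S l ∧ j ∈ T l then 1 else 0 with hB
  refine ⟨B, ⟨fun i j => ?_, k, S, T, hdS, hdT, fun i j => ?_⟩, ?_, fun i j h => ?_⟩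
  · simp only [hB]; split_ifs <;> simp
  · simp only [hB]; split_ifs with h <;> simp [h]
  · have hBcount : ∑ l, (S l).card * (T l).card ≤ numOnes B := by
      have h2 : ((Finset.univ : Finset (Fin k)).biUnion fun l => S l ×ˢ T l).card =
          ∑ l, (S l).card * (T l).card := by
        rw [Finset.card_biUnion]
        · exact Finset.sum_congr rfl fun l _ => Finset.card_product _ _
        · intro a _ b _ hab
          exact Finset.disjoint_product.2 (Or.inl (hdS a b hab))
      rw [← h2, numOnes]
      refine Finset.card_le_card fun p hp => ?_
      obtain ⟨l, -, hl⟩ := Finset.mem_biUnion.1 hp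
      rw [Finset.mem_product] at hl
      exact Finset.mem_filter.2 ⟨Finset.mem_univ _, if_pos ⟨l, hl⟩⟩
    rw [div_le_iff₀ (by positivity), mul_comm]
    have h3 : (numOnes A : ℝ) ≤ 2 ^ (10 ^ 6 * L ^ 6) * numOnes B := by
      rw [numOnes_eq_edgeCount]
      exact_mod_cast hcov.trans (Nat.mul_le_mul_left _ hBcount)
    exact h3.trans (mul_le_mul_of_nonneg_right (two_pow_bound hlam1 hLlam) (Nat.cast_nonneg _))
  · simp only [hB] at h
    split_ifs at h with h'
    · obtain ⟨l, hi, hj⟩ := h'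
      exact hE l i hi j hj
    · exact absurd h zero_ne_one
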